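/- **Setting.** A *tree* is a finite rooted planar binary tree. A *representative triple* $(T_-,\beta,T_+)$ consists of two trees with the same number $n$ of leaves and a braid $\beta\in B_n$, regarded as joining the leaves of $T_+$ (at the bottom) to the leaves of $T_-$ (at the top); let $\rho(\beta)\in S_n$ send the bottom position of each strand to its top position. For $1\le k\le n$, the $k$-th *expansion* of $(T_-,\beta,T_+)$ is the triple obtained by adding a caret to the $k$-th leaf of $T_+$, adding a caret to the $\rho(\beta)(k)$-th leaf of $T_-$, and bifurcating the $k$-th strand of $\beta$ (counted at the bottom) into two parallel strands. The *braided Thompson group* $bV$ is the set of classes $[T_-,\beta,T_+]$ of representative triples under the equivalence relation generated by expansion, with the multiplication determined by $[T_-,\beta,T][T,\gamma,T_+]=[T_-,\beta\gamma,T_+]$ (any two elements have representatives that can be multiplied in this way). Let $\widehat{B}_n$ be the standard copy of $B_{n-1}$ in $B_n$ which only braids the first $n-1$ strands; $\widehat{bV}\le bV$ is the subgroup of all elements that can be written as $[T_-,\beta,T_+]$ with $\beta\in\widehat{B}_n$ for the corresponding $n$. A function $q\colon\Gamma\to\mathbf{R}$ on a group $\Gamma$ is a *quasimorphism* if $\sup_{g,h\in\Gamma}|q(g)+q(h)-q(gh)|<\infty$.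 **Corollary.** For every quasimorphism $q\colon bV\to\mathbf{R}$, the image $q(\widehat{bV})$ is bounded. Moreover, there is no uniform-length factorisation of the elements of $bV$ into conjugates of elements of $\widehat{bV}$: there is no $N\in\mathbf{N}$ such that every element of $bV$ is a product of at most $N$ elements of the form $chc^{-1}$ with $c\in bV$ and $h\in\widehat{bV}$. -/

import Mathlib

namespace BraidedThompson

/-! ### Braid groups -/

/-- The Artin relators for the braid group on `n` strands; the generator with index
`i : Fin (n - 1)` braids the strands in (zero-based) positions `i` and `i + 1`. -/
def artinRels (n : ℕ) : Set (FreeGroup (Fin (n - 1))) :=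
  {r | ∃ i j : Fin (n - 1), (i : ℕ) + 1 < j ∧
      r = (FreeGroup.of i * FreeGroup.of j) * (FreeGroup.of j * FreeGroup.of i)⁻¹} ∪
  {r | ∃ i j : Fin (n - 1), (i : ℕ) + 1 = j ∧
      r = (FreeGroup.of i * FreeGroup.of j * FreeGroup.of i) *
        (FreeGroup.of j * FreeGroup.of i * FreeGroup.of j)⁻¹}

/-- The braid group `B_n` on `n` strands, given by Artin's presentation. A product `β * γ` is the
braid with `β` stacked on top of `γ`. -/
abbrev Braid (n : ℕ) : Type := PresentedGroup (artinRels n)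

/-- The standard generator of `B_n` crossing the strands in the (zero-based) positions `i` and
`i + 1`; by convention it is `1` when `i + 1 < n` fails. -/
def sigma (n i : ℕ) : Braid n :=
  if h : i < n - 1 then PresentedGroup.of ⟨i, h⟩ else 1

theorem of_eq_sigma {n : ℕ} (i : Fin (n - 1)) :
    (PresentedGroup.of i : Braid n) = sigma n i := by
  simp [sigma]

theorem sigma_comm {n i j : ℕ} (h : i + 1 < j) (hj : j + 1 < n) :
    sigma n i * sigma n j = sigma n j * sigma n i := by
  rw [sigma, sigma, dif_pos (by omega), dif_pos (by omega)]
  exact PresentedGroup.mk_eq_mk_of_mul_inv_mem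
    (Or.inl ⟨⟨i, by omega⟩, ⟨j, by omega⟩, h, rfl⟩)

theorem sigma_braid {n i : ℕ} (h : i + 2 < n) :
    sigma n i * sigma n (i + 1) * sigma n i =
      sigma n (i + 1) * sigma n i * sigma n (i + 1) := by
  rw [sigma, sigma, dif_pos (by omega), dif_pos (by omega)]
  exact PresentedGroup.mk_eq_mk_of_mul_inv_mem
    (Or.inr ⟨⟨i, by omega⟩, ⟨i + 1, by omega⟩, rfl, rfl⟩)

/-- The transposition of the positions `i` and `i + 1`. -/
def genPerm {n : ℕ} (i : Fin (n - 1)) : Equiv.Perm (Fin n) :=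
  Equiv.swap ⟨i, by omega⟩ ⟨i + 1, by omega⟩

/-- The braid on `n + 1` strands obtained from the `i`-th standard generator of `B_n` by
bifurcating the strand which starts at the bottom in position `k` into two parallel strands. -/
def genBif (n i k : ℕ) : Braid (n + 1) :=
  if k < i then sigma (n + 1) (i + 1)
  else if k = i then sigma (n + 1) i * sigma (n + 1) (i + 1)
  else if k = i + 1 then sigma (n + 1) (i + 1) * sigma (n + 1) i
  else sigma (n + 1) i

theorem genBif_lt (n : ℕ) {i k : ℕ} (h : k < i) : genBif n i k = sigma (n + 1) (i + 1) := by
  rw [genBif, if_pos h]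

theorem genBif_self (n i : ℕ) : genBif n i i = sigma (n + 1) i * sigma (n + 1) (i + 1) := by
  simp [genBif]

theorem genBif_succ (n i : ℕ) :
    genBif n i (i + 1) = sigma (n + 1) (i + 1) * sigma (n + 1) i := by
  simp [genBif]

theorem genBif_gt (n : ℕ) {i k : ℕ} (h : i + 1 < k) : genBif n i k = sigma (n + 1) i := by
  rw [genBif, if_neg (by omega), if_neg (by omega), if_neg (by omega)]

/-- The transposition of `i` and `i + 1` in the natural numbers, as a function. -/
def natSwap (i m : ℕ) : ℕ := if m = i then i + 1 else if m = i + 1 then i else m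

theorem natSwap_lt {i m : ℕ} (h : m < i) : natSwap i m = m := by
  rw [natSwap, if_neg (by omega), if_neg (by omega)]

theorem natSwap_self (i : ℕ) : natSwap i i = i + 1 := by simp [natSwap]

theorem natSwap_succ (i : ℕ) : natSwap i (i + 1) = i := by simp [natSwap]

theorem natSwap_gt {i m : ℕ} (h : i + 1 < m) : natSwap i m = m := by
  rw [natSwap, if_neg (by omega), if_neg (by omega)]

theorem genPerm_val {n : ℕ} (i : Fin (n - 1)) (m : Fin n) :
    (genPerm i m : ℕ) = natSwap i m := by
  unfold genPerm natSwap
  rw [Equiv.swap_apply_def]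
  simp only [Fin.ext_iff]
  split_ifs <;> rfl

theorem genPerm_inv {n : ℕ} (i : Fin (n - 1)) : (genPerm i)⁻¹ = genPerm i :=
  Equiv.swap_inv _ _

/-- The `i`-th standard generator of `B_n` together with the results of bifurcating each of its
strands, the strands being indexed by their position at the top. -/
def genCable (n : ℕ) (i : Fin (n - 1)) :
    (Fin n → Braid (n + 1)) ⋊[mulAutArrow] Equiv.Perm (Fin n) :=
  ⟨fun m => genBif n i ((genPerm i)⁻¹ m), genPerm i⟩

theorem cable_mul_left {n : ℕ} {H : Type*} [Group H]
    (a b : (Fin n → H) ⋊[mulAutArrow] Equiv.Perm (Fin n)) (m : Fin n) :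
    (a * b).left m = a.left m * b.left (a.right⁻¹ m) := rfl

theorem genCable_comm {n : ℕ} (i j : Fin (n - 1)) (h : (i : ℕ) + 1 < j) :
    genCable n i * genCable n j = genCable n j * genCable n i := by
  have hj := j.2
  apply SemidirectProduct.ext
  · funext m
    have e1 := sigma_comm (n := n + 1) (i := i) (j := j) h (by omega)
    have e2 := sigma_comm (n := n + 1) (i := i) (j := j + 1) (by omega) (by omega)
    have e3 := sigma_comm (n := n + 1) (i := i + 1) (j := j + 1) (by omega) (by omega)
    have e2' : ∀ x, sigma (n + 1) i * (sigma (n + 1) (j + 1) * x) =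
        sigma (n + 1) (j + 1) * (sigma (n + 1) i * x) := fun x => by
      rw [← mul_assoc, e2, mul_assoc]
    have e1' : ∀ x, sigma (n + 1) i * (sigma (n + 1) j * x) =
        sigma (n + 1) j * (sigma (n + 1) i * x) := fun x => by
      rw [← mul_assoc, e1, mul_assoc]
    have e3' : ∀ x, sigma (n + 1) (i + 1) * (sigma (n + 1) (j + 1) * x) =
        sigma (n + 1) (j + 1) * (sigma (n + 1) (i + 1) * x) := fun x => by
      rw [← mul_assoc, e3, mul_assoc]
    simp only [cable_mul_left, genCable, genPerm_inv, genPerm_val]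
    generalize (m : ℕ) = m
    have h6 : m < i ∨ m = i ∨ m = i + 1 ∨ (i + 1 < m ∧ m < j) ∨ m = j ∨ m = j + 1 ∨ j + 1 < m := by
      omega
    rcases h6 with h1 | rfl | rfl | h1 | rfl | rfl | h1
    all_goals
      simp (disch := omega) only [natSwap_lt, natSwap_self, natSwap_succ, natSwap_gt, genBif_lt,
        genBif_self, genBif_succ, genBif_gt, mul_assoc, e1, e2, e3, e1', e2', e3']
  · ext m
    simp only [genCable, SemidirectProduct.mul_right, Equiv.Perm.mul_apply, genPerm_val, natSwap]
    split_ifs <;> omega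

theorem braid_rel_one {G : Type*} [Group G] {a b c : G} (h : a * b * a = b * a * b)
    (h2 : b * c * b = c * b * c) (h3 : a * c = c * a) :
    (b * a) * (c * b) * a = c * (b * a) * (c * b) := by
  calc (b * a) * (c * b) * a = b * (a * c) * b * a := by group
    _ = b * c * (a * b * a) := by rw [h3]; group
    _ = (b * c * b) * a * b := by rw [h]; group
    _ = c * b * (c * a) * b := by rw [h2]; group
    _ = c * (b * a) * (c * b) := by rw [← h3]; group

theorem braid_rel_two {G : Type*} [Group G] {a b c : G} (h : a * b * a = b * a * b)
    (h2 : b * c * b = c * b * c) (h3 : a * c = c * a) :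
    (a * b) * c * (b * a) = (c * b) * a * (b * c) := by
  calc (a * b) * c * (b * a) = a * (b * c * b) * a := by group
    _ = (a * c) * b * (c * a) := by rw [h2]; group
    _ = (c * a) * b * (a * c) := by rw [h3]
    _ = c * (a * b * a) * c := by group
    _ = (c * b) * a * (b * c) := by rw [h]; group

theorem braid_rel_three {G : Type*} [Group G] {a b c : G} (h : a * b * a = b * a * b)
    (h2 : b * c * b = c * b * c) (h3 : a * c = c * a) :
    a * (b * c) * (a * b) = (b * c) * (a * b) * c := by
  calc a * (b * c) * (a * b) = a * b * (c * a) * b := by group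
    _ = (a * b * a) * c * b := by rw [← h3]; group
    _ = b * a * (b * c * b) := by rw [h]; group
    _ = b * (a * c) * b * c := by rw [h2]; group
    _ = (b * c) * (a * b) * c := by rw [h3]; group

theorem genCable_braid {n : ℕ} (i j : Fin (n - 1)) (h : (i : ℕ) + 1 = j) :
    genCable n i * genCable n j * genCable n i = genCable n j * genCable n i * genCable n j := by
  have hj := j.2
  apply SemidirectProduct.ext
  · funext m
    have e1 := sigma_braid (n := n + 1) (i := i) (by omega)
    have e2 := sigma_braid (n := n + 1) (i := i + 1) (by omega)
    have e3 := sigma_comm (n := n + 1) (i := i) (j := i + 1 + 1) (by omega) (by omega)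
    simp only [cable_mul_left, SemidirectProduct.mul_right, mul_inv_rev, Equiv.Perm.mul_apply,
      genCable, genPerm_inv, genPerm_val, ← h]
    generalize (m : ℕ) = m
    have h6 : m < i ∨ m = i ∨ m = i + 1 ∨ m = i + 1 + 1 ∨ i + 1 + 1 < m := by
      omega
    rcases h6 with h1 | rfl | rfl | rfl | h1
    all_goals
      simp (disch := omega) only [natSwap_lt, natSwap_self, natSwap_succ, natSwap_gt, genBif_lt,
        genBif_self, genBif_succ, genBif_gt]
    · exact e2
    · exact braid_rel_one e1 e2 e3
    · exact braid_rel_two e1 e2 e3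
    · exact braid_rel_three e1 e2 e3
    · exact e1
  · ext m
    simp only [genCable, SemidirectProduct.mul_right, Equiv.Perm.mul_apply, genPerm_val, natSwap,
      ← h]
    split_ifs <;> omega

/-- The homomorphism which sends a braid to its permutation together with the results of
bifurcating each of its strands, the strands being indexed by their position at the top. (The
multiplication of the wreath product says how bifurcating a strand of `β * γ` bifurcates the
corresponding strands of `β` and of `γ`.) -/
def cable (n : ℕ) : Braid n →* (Fin n → Braid (n + 1)) ⋊[mulAutArrow] Equiv.Perm (Fin n) :=
  PresentedGroup.toGroup (f := genCable n) (by
    rintro r (⟨i, j, h, rfl⟩ | ⟨i, j, h, rfl⟩)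
    · simp only [map_mul, map_inv, FreeGroup.lift_apply_of, mul_inv_eq_one]
      exact genCable_comm i j h
    · simp only [map_mul, map_inv, FreeGroup.lift_apply_of, mul_inv_eq_one]
      exact genCable_braid i j h)

/-- The permutation `ρ(β)` of a braid `β`: the strand of `β` starting at the bottom in position `k`
ends at the top in position `ρ(β)(k)`. -/
def rho {n : ℕ} : Braid n →* Equiv.Perm (Fin n) :=
  SemidirectProduct.rightHom.comp (cable n)

/-- The braid obtained from `β` by bifurcating the strand starting at the bottom in position `k`
into two parallel strands. -/
def bifurcate {n : ℕ} (k : Fin n) (β : Braid n) : Braid (n + 1) :=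
  (cable n β).left (rho β k)

theorem rho_of {n : ℕ} (i : Fin (n - 1)) :
    rho (PresentedGroup.of i : Braid n) = genPerm i := by
  simp [rho, cable, genCable]

theorem bifurcate_of {n : ℕ} (i : Fin (n - 1)) (k : Fin n) :
    bifurcate k (PresentedGroup.of i : Braid n) = genBif n i k := by
  rw [bifurcate, rho_of]
  simp [cable, genCable]

theorem rho_sigma_val {n i : ℕ} (h : i + 1 < n) (m : Fin n) :
    (rho (sigma n i) m : ℕ) = natSwap i m := by
  rw [sigma, dif_pos (by omega), rho_of, genPerm_val]

theorem bifurcate_sigma {n i : ℕ} (h : i + 1 < n) (k : Fin n) :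
    bifurcate k (sigma n i) = genBif n i k := by
  rw [sigma, dif_pos (by omega), bifurcate_of]

theorem bifurcate_mul {n : ℕ} (k : Fin n) (β γ : Braid n) :
    bifurcate k (β * γ) = bifurcate (rho γ k) β * bifurcate k γ := by
  have h : (cable n β).right = rho β := rfl
  simp [bifurcate, cable_mul_left, h]

theorem bifurcate_one {n : ℕ} (k : Fin n) : bifurcate k (1 : Braid n) = 1 := by
  simp [bifurcate]

theorem bifurcate_inv {n : ℕ} (k : Fin n) (β : Braid n) :
    bifurcate (rho β k) β⁻¹ = (bifurcate k β)⁻¹ := by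
  have := bifurcate_mul k β⁻¹ β
  rw [inv_mul_cancel, bifurcate_one] at this
  exact eq_inv_of_mul_eq_one_left this.symm

theorem braid_induction {n : ℕ} {P : Braid n → Prop} (h1 : P 1)
    (hof : ∀ i : Fin (n - 1), P (PresentedGroup.of i))
    (hmul : ∀ β γ, P β → P γ → P (β * γ)) (hinv : ∀ β, P β → P β⁻¹) (β : Braid n) : P β :=
  PresentedGroup.generated_by (artinRels n)
    { carrier := {β | P β}, mul_mem' := fun {a b} => hmul a b, one_mem' := h1,
      inv_mem' := fun {a} => hinv a } hof β

/-- The position of strand `j` after the strand `k` has been bifurcated (for `j = k`, this is the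
right one of the two new strands). -/
def skip {n : ℕ} (k j : Fin n) : Fin (n + 1) :=
  ⟨if (j : ℕ) < k then j else j + 1, by split_ifs <;> omega⟩

theorem rho_bifurcate {n : ℕ} (β : Braid n) : ∀ k : Fin n,
    rho (bifurcate k β) k.castSucc = (rho β k).castSucc ∧
      ∀ j, rho (bifurcate k β) (skip k j) = skip (rho β k) (rho β j) := by
  induction β using braid_induction with
  | h1 => simp [bifurcate_one]
  | hof i =>
    intro k
    have hi := i.2
    rw [bifurcate_of, rho_of]
    have aux : ∀ m : Fin (n + 1), (rho (genBif n i k) m : ℕ) =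
        if (k : ℕ) < i then natSwap (i + 1) m
        else if (k : ℕ) = i then natSwap i (natSwap (i + 1) m)
        else if (k : ℕ) = i + 1 then natSwap (i + 1) (natSwap i m)
        else natSwap i m := fun m => by
      rw [genBif]
      split_ifs <;>
        simp (disch := omega) only [map_mul, Equiv.Perm.mul_apply, rho_sigma_val]
    refine ⟨Fin.ext ?_, fun j => Fin.ext ?_⟩
    · simp only [aux, genPerm_val, Fin.val_castSucc, natSwap]
      split_ifs <;> omega
    · simp only [aux, genPerm_val, skip, natSwap]
      split_ifs <;> omega
  | hmul β γ hβ hγ =>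
    intro k
    simp [bifurcate_mul, hβ, hγ]
  | hinv β hβ =>
    intro k
    obtain ⟨k, rfl⟩ := (rho β).surjective k
    rw [bifurcate_inv, map_inv, map_inv, Equiv.Perm.inv_eq_iff_eq]
    refine ⟨by simp [hβ], fun j => ?_⟩
    rw [Equiv.Perm.inv_eq_iff_eq]
    simp [hβ]

theorem bifurcate_bifurcate {n : ℕ} (β : Braid n) : ∀ j k : Fin n, j ≠ k →
    bifurcate (skip j k) (bifurcate j β) = bifurcate (skip k j) (bifurcate k β) := by
  induction β using braid_induction with
  | h1 => simp [bifurcate_one]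
  | hof i =>
    intro j k h
    wlog hjk : j < k generalizing j k
    · exact (this k j h.symm (lt_of_le_of_ne (not_lt.1 hjk) h.symm)).symm
    have hi := i.2
    have hk := k.2
    have hs : (skip j k : ℕ) = k + 1 := by simp only [skip]; split_ifs <;> omega
    have hs' : (skip k j : ℕ) = j := by simp only [skip]; split_ifs <;> omega
    have hjk' : (j : ℕ) < k := hjk
    rw [bifurcate_of, bifurcate_of]
    have aux : ∀ (p : Fin n) (m : Fin (n + 1)), bifurcate m (genBif n i p) =
        if (p : ℕ) < i then genBif (n + 1) (i + 1) m
        else if (p : ℕ) = i then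
          genBif (n + 1) i (natSwap (i + 1) m) * genBif (n + 1) (i + 1) m
        else if (p : ℕ) = i + 1 then
          genBif (n + 1) (i + 1) (natSwap i m) * genBif (n + 1) i m
        else genBif (n + 1) i m := fun p m => by
      rw [genBif]
      split_ifs <;>
        simp (disch := omega) only [bifurcate_mul, bifurcate_sigma, rho_sigma_val]
    rw [aux, aux, hs, hs']
    have e3 := sigma_comm (n := n + 1 + 1) (i := i) (j := i + 1 + 1) (by omega) (by omega)
    have e : ∀ x, sigma (n + 1 + 1) i * (sigma (n + 1 + 1) (i + 1 + 1) * x) =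
        sigma (n + 1 + 1) (i + 1 + 1) * (sigma (n + 1 + 1) i * x) := fun x => by
      rw [← mul_assoc, e3, mul_assoc]
    have hcases : ((j : ℕ) < i ∨ (j : ℕ) = i ∨ (j : ℕ) = i + 1 ∨ i + 1 < (j : ℕ)) := by omega
    have hcases' : ((k : ℕ) < i ∨ (k : ℕ) = i ∨ (k : ℕ) = i + 1 ∨ i + 1 < (k : ℕ)) := by omega
    generalize (j : ℕ) = j' at *
    generalize (k : ℕ) = k' at *
    rcases hcases with h1 | rfl | rfl | h1 <;> rcases hcases' with h2 | rfl | rfl | h2 <;>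
      first
      | omega
      | simp (disch := omega) only [if_pos, if_neg, natSwap_lt, natSwap_self, natSwap_succ,
          natSwap_gt, genBif_lt, genBif_self, genBif_succ, genBif_gt, mul_assoc, e, if_true,
          if_false, Nat.lt_irrefl, Nat.succ_ne_self]
  | hmul β γ hβ hγ =>
    intro j k h
    rw [bifurcate_mul, bifurcate_mul, bifurcate_mul, bifurcate_mul, (rho_bifurcate γ j).2,
      (rho_bifurcate γ k).2, hγ j k h, hβ _ _ (by simpa using h)]
  | hinv β hβ =>
    intro j k h
    obtain ⟨j, rfl⟩ := (rho β).surjective j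
    obtain ⟨k, rfl⟩ := (rho β).surjective k
    have h' : j ≠ k := by simpa using h
    rw [bifurcate_inv, bifurcate_inv, ← (rho_bifurcate β j).2, ← (rho_bifurcate β k).2,
      bifurcate_inv, bifurcate_inv, hβ j k h']

/-! ### Trees -/

/-- Finite rooted planar binary trees; the leaves are the copies of `BinaryTree.nil`, and they are
numbered `0, 1, …, numLeaves - 1` from left to right. -/
abbrev PTree : Type := BinaryTree Unit

/-- The tree obtained from `T` by adding a caret to its `k`-th leaf (meant for
`k < T.numLeaves`). -/
def addCaret : PTree → ℕ → PTree
  | .nil, _ => .node () .nil .nil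
  | .node _ l r, k =>
    if k < l.numLeaves then .node () (addCaret l k) r
    else .node () l (addCaret r (k - l.numLeaves))

theorem numLeaves_pos (T : PTree) : 0 < T.numLeaves := by
  cases T with
  | nil => simp
  | node _ l r => have := numLeaves_pos l; simp; omega

theorem numLeaves_addCaret (T : PTree) (k : ℕ) :
    (addCaret T k).numLeaves = T.numLeaves + 1 := by
  induction T generalizing k with
  | nil => simp [addCaret]
  | node _ l r hl hr =>
    rw [addCaret]
    split_ifs
    · simp [hl]; omega
    · simp [hr]; omega

theorem addCaret_comm (T : PTree) {j k : ℕ} (hjk : j < k) (hk : k < T.numLeaves) :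
    addCaret (addCaret T j) (k + 1) = addCaret (addCaret T k) j := by
  induction T generalizing j k with
  | nil => simp at hk; omega
  | node _ l r hl hr =>
    simp only [BinaryTree.numLeaves] at hk
    by_cases h1 : k < l.numLeaves
    · have h2 : j < l.numLeaves := by omega
      simp only [addCaret, h1, h2, if_true, numLeaves_addCaret]
      rw [if_pos (by omega), if_pos (by omega), hl hjk h1]
    · by_cases h2 : j < l.numLeaves
      · simp only [addCaret, h1, h2, if_true, if_false, numLeaves_addCaret]
        rw [if_neg (by omega), Nat.add_sub_add_right]
      · simp only [addCaret, h1, h2, if_false]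
        rw [if_neg (by omega), show k + 1 - l.numLeaves = k - l.numLeaves + 1 by omega,
          hr (by omega) (by omega)]

theorem addCaret_skip (T : PTree) {n : ℕ} (h : T.numLeaves = n) {j k : Fin n} (hjk : j ≠ k) :
    addCaret (addCaret T j) (skip j k) = addCaret (addCaret T k) (skip k j) := by
  have := j.2
  have := k.2
  rcases lt_or_gt_of_ne (fun e => hjk (Fin.ext e) : (j : ℕ) ≠ k) with h1 | h1
  · simp only [skip]
    rw [if_neg (by omega), if_pos h1, addCaret_comm T h1 (by omega)]
  · simp only [skip]
    rw [if_pos h1, if_neg (by omega), addCaret_comm T h1 (by omega)]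

/-- `Sub T U` says that `U` is obtained from `T` by hanging trees on the leaves of `T`. -/
def Sub : PTree → PTree → Prop
  | .nil, _ => True
  | .node _ _ _, .nil => False
  | .node _ l r, .node _ l' r' => Sub l l' ∧ Sub r r'

theorem Sub.rfl (T : PTree) : Sub T T := by
  induction T with
  | nil => trivial
  | node _ l r hl hr => exact ⟨hl, hr⟩

theorem Sub.numLeaves_le {T U : PTree} (h : Sub T U) : T.numLeaves ≤ U.numLeaves := by
  induction T generalizing U with
  | nil => exact numLeaves_pos U
  | node _ l r hl hr =>
    cases U with
    | nil => exact h.elim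
    | node _ l' r' => exact Nat.add_le_add (hl h.1) (hr h.2)

theorem sub_addCaret (T : PTree) (k : ℕ) : Sub T (addCaret T k) := by
  induction T generalizing k with
  | nil => trivial
  | node _ l r hl hr =>
    rw [addCaret]
    split_ifs
    · exact ⟨hl _, Sub.rfl r⟩
    · exact ⟨Sub.rfl l, hr _⟩

theorem Sub.trans {T U W : PTree} (h : Sub T U) (h' : Sub U W) : Sub T W := by
  induction T generalizing U W with
  | nil => trivial
  | node _ l r hl hr =>
    cases U with
    | nil => exact h.elim
    | node _ l' r' =>
      cases W with
      | nil => exact h'.elim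
      | node _ l'' r'' => exact ⟨hl h.1 h'.1, hr h.2 h'.2⟩

theorem Sub.eq_or_exists {T U : PTree} (h : Sub T U) :
    T = U ∨ ∃ k < T.numLeaves, Sub (addCaret T k) U := by
  induction T generalizing U with
  | nil =>
    cases U with
    | nil => exact Or.inl _root_.rfl
    | node _ l r => exact Or.inr ⟨0, by simp, trivial, trivial⟩
  | node _ l r hl hr =>
    cases U with
    | nil => exact h.elim
    | node _ l' r' =>
      rcases hl h.1 with rfl | ⟨k, hk, hs⟩
      · rcases hr h.2 with rfl | ⟨k, hk, hs⟩
        · exact Or.inl _root_.rfl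
        · refine Or.inr ⟨l.numLeaves + k, by simpa using hk, ?_⟩
          rw [addCaret, if_neg (by omega), Nat.add_sub_cancel_left]
          exact ⟨Sub.rfl l, hs⟩
      · refine Or.inr ⟨k, by simp; omega, ?_⟩
        rw [addCaret, if_pos hk]
        exact ⟨hs, h.2⟩

theorem Sub.addCaret_addCaret {T U : PTree} {j k : ℕ} (hjk : j < k) (hk : k < T.numLeaves)
    (h1 : Sub (addCaret T j) U) (h2 : Sub (addCaret T k) U) :
    Sub (addCaret (addCaret T j) (k + 1)) U := by
  induction T generalizing j k U with
  | nil => simp at hk; omega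
  | node _ l r hl hr =>
    simp only [BinaryTree.numLeaves] at hk
    cases U with
    | nil =>
      rw [addCaret] at h1
      split_ifs at h1 <;> exact h1.elim
    | node _ l' r' =>
      rw [addCaret] at h1 h2
      by_cases hk' : k < l.numLeaves
      · have hj' : j < l.numLeaves := by omega
        rw [if_pos hj'] at h1
        rw [if_pos hk'] at h2
        rw [addCaret, if_pos hj', addCaret, numLeaves_addCaret, if_pos (by omega)]
        exact ⟨hl hjk hk' h1.1 h2.1, h1.2⟩
      · rw [if_neg hk'] at h2
        by_cases hj' : j < l.numLeaves
        · rw [if_pos hj'] at h1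
          rw [addCaret, if_pos hj', addCaret, numLeaves_addCaret, if_neg (by omega),
            Nat.add_sub_add_right]
          exact ⟨h1.1, h2.2⟩
        · rw [if_neg hj'] at h1
          rw [addCaret, if_neg hj', addCaret, if_neg (by omega),
            show k + 1 - l.numLeaves = k - l.numLeaves + 1 by omega]
          exact ⟨h1.1, hr (by omega) (by omega) h1.2 h2.2⟩

theorem exists_sub_sub (T U : PTree) : ∃ W, Sub T W ∧ Sub U W := by
  induction T generalizing U with
  | nil => exact ⟨U, trivial, Sub.rfl U⟩
  | node _ l r hl hr =>
    cases U with
    | nil => exact ⟨.node () l r, Sub.rfl _, trivial⟩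
    | node _ l' r' =>
      obtain ⟨w, h1, h2⟩ := hl l'
      obtain ⟨w', h1', h2'⟩ := hr r'
      exact ⟨.node () w w', ⟨h1, h1'⟩, ⟨h2, h2'⟩⟩

/-! ### Representative triples and expansions -/

/-- A representative triple `(T₋, β, T₊)`: two trees with the same number `n` of leaves and a
braid on `n` strands, connecting the leaves of `T₊` (bottom) to the leaves of `T₋` (top). -/
structure Triple where
  /-- the common number of leaves -/
  n : ℕ
  /-- the tree `T₋` -/
  left : PTree
  /-- the tree `T₊` -/
  right : PTree
  left_leaves : left.numLeaves = n
  right_leaves : right.numLeaves = n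
  /-- the braid -/
  braid : Braid n

/-- The `k`-th expansion of a representative triple. -/
def Triple.expand (t : Triple) (k : Fin t.n) : Triple where
  n := t.n + 1
  left := addCaret t.left (rho t.braid k)
  right := addCaret t.right k
  left_leaves := by rw [numLeaves_addCaret, t.left_leaves]
  right_leaves := by rw [numLeaves_addCaret, t.right_leaves]
  braid := bifurcate k t.braid

/-- `Expands t t'` says that `t'` is an expansion of `t`. -/
def Expands (t t' : Triple) : Prop := ∃ k : Fin t.n, t' = t.expand k

/-- Equivalence of representative triples: the equivalence relation generated by expansion. -/
instance tripleSetoid : Setoid Triple := Relation.EqvGen.setoid Expands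

/-- The underlying type of the braided Thompson group `bV`: equivalence classes of representative
triples. -/
def BV : Type := Quotient tripleSetoid

/-- The class `[T₋, β, T₊]` of a representative triple. -/
def Triple.toBV (t : Triple) : BV := Quotient.mk tripleSetoid t

/-- `Comp a b c` says that `a = (T₋, β, T)`, `b = (T, γ, T₊)` and `c = (T₋, β * γ, T₊)`. -/
inductive Comp : Triple → Triple → Triple → Prop
  | mk (n : ℕ) (l m r : PTree) (hl : l.numLeaves = n) (hm : m.numLeaves = n)
      (hr : r.numLeaves = n) (β γ : Braid n) :
      Comp ⟨n, l, m, hl, hm, β⟩ ⟨n, m, r, hm, hr, γ⟩ ⟨n, l, r, hl, hr, β * γ⟩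

theorem Triple.expand_expand (t : Triple) {j k : Fin t.n} (h : j ≠ k) :
    (t.expand j).expand (skip j k) = (t.expand k).expand (skip k j) := by
  obtain ⟨n, l, r, hl, hr, β⟩ := t
  change Fin n at j k
  have e1 := bifurcate_bifurcate β j k h
  have e2 := addCaret_skip r hr h
  have e3 := addCaret_skip l hl (j := rho β j) (k := rho β k) (by simpa using h)
  rw [← (rho_bifurcate β j).2, ← (rho_bifurcate β k).2] at e3
  simp only [Triple.expand, Triple.mk.injEq, heq_eq_eq, true_and]
  exact ⟨e3, e2, e1⟩

open Relation in
theorem exists_common {a b c : Triple} (hb : ReflTransGen Expands a b)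
    (hc : ReflTransGen Expands a c) :
    ∃ d, ReflTransGen Expands b d ∧ ReflTransGen Expands c d := by
  refine church_rosser ?_ hb hc
  rintro a _ _ ⟨j, rfl⟩ ⟨k, rfl⟩
  by_cases h : j = k
  · subst h
    exact ⟨_, .refl, .refl⟩
  · exact ⟨_, .single ⟨skip j k, _root_.rfl⟩, .single ⟨skip k j, a.expand_expand h⟩⟩

open Relation in
theorem toBV_eq_iff {a b : Triple} : a.toBV = b.toBV ↔
    ∃ c, ReflTransGen Expands a c ∧ ReflTransGen Expands b c := by
  constructor
  · intro h
    have h' : EqvGen Expands a b := Quotient.exact h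
    clear h
    induction h' with
    | rel x y h => exact ⟨y, .single h, .refl⟩
    | refl x => exact ⟨x, .refl, .refl⟩
    | symm x y _ ih => obtain ⟨c, h1, h2⟩ := ih; exact ⟨c, h2, h1⟩
    | trans x y z _ _ ih1 ih2 =>
      obtain ⟨c, h1, h2⟩ := ih1
      obtain ⟨d, h3, h4⟩ := ih2
      obtain ⟨e, h5, h6⟩ := exists_common h2 h3
      exact ⟨e, h1.trans h5, h4.trans h6⟩
  · rintro ⟨c, h1, h2⟩
    have key : ∀ {x y : Triple}, ReflTransGen Expands x y → x.toBV = y.toBV := fun h => by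
      induction h with
      | refl => exact _root_.rfl
      | tail _ h ih => exact ih.trans (Quotient.sound (EqvGen.rel _ _ h))
    exact (key h1).trans (key h2).symm

open Relation in
theorem toBV_eq {a b : Triple} (h : ReflTransGen Expands a b) : a.toBV = b.toBV :=
  toBV_eq_iff.2 ⟨b, h, .refl⟩

theorem BV.exists_rep (x : BV) : ∃ t : Triple, t.toBV = x := Quotient.exists_rep x

open Relation in
theorem sub_of_expands {a b : Triple} (h : ReflTransGen Expands a b) : Sub a.right b.right := by
  induction h with
  | refl => exact Sub.rfl _
  | tail _ h ih =>
    obtain ⟨k, rfl⟩ := h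
    exact ih.trans (sub_addCaret _ _)

open Relation in
/-- A triple can be expanded so that its right tree becomes any prescribed larger tree. -/
theorem exists_expands (U : PTree) (t : Triple) (h : Sub t.right U) :
    ∃ t', ReflTransGen Expands t t' ∧ t'.right = U := by
  rcases h.eq_or_exists with h' | ⟨k, hk, hs⟩
  · exact ⟨t, .refl, h'⟩
  · have hk' : k < t.n := t.right_leaves ▸ hk
    have hlt := hs.numLeaves_le
    rw [numLeaves_addCaret] at hlt
    have hdec : U.numLeaves - (t.expand ⟨k, hk'⟩).right.numLeaves <
        U.numLeaves - t.right.numLeaves := by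
      have e : (t.expand ⟨k, hk'⟩).right.numLeaves = t.right.numLeaves + 1 :=
        numLeaves_addCaret _ _
      omega
    obtain ⟨t', h1, h2⟩ := exists_expands U (t.expand ⟨k, hk'⟩) hs
    exact ⟨t', .head ⟨_, _root_.rfl⟩ h1, h2⟩
termination_by U.numLeaves - t.right.numLeaves

open Relation in
/-- An iterated expansion of a triple is determined by its right tree. -/
theorem expands_unique (U : PTree) (t a b : Triple) (ha : ReflTransGen Expands t a)
    (hb : ReflTransGen Expands t b) (ha' : a.right = U) (hb' : b.right = U) : a = b := by
  have hstep : ∀ (c : Triple) (k : Fin t.n), ReflTransGen Expands (t.expand k) c →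
      c.right = U → U.numLeaves - (t.expand k).right.numLeaves < U.numLeaves - t.right.numLeaves :=
    fun c k h1 h2 => by
      have := (sub_of_expands h1).numLeaves_le
      rw [h2] at this
      simp only [Triple.expand, numLeaves_addCaret] at this ⊢
      omega
  have hend : ∀ (c : Triple) (k : Fin t.n), ReflTransGen Expands (t.expand k) c →
      c.right = U → t.right = U → False := fun c k h1 h2 h3 => by
    have := (sub_of_expands h1).numLeaves_le
    rw [h2, ← h3] at this
    simp only [Triple.expand, numLeaves_addCaret] at this
    omega
  rcases ha.cases_head with rfl | ⟨_, ⟨j, rfl⟩, h1⟩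
  · rcases hb.cases_head with rfl | ⟨_, ⟨k, rfl⟩, h2⟩
    · exact _root_.rfl
    · exact (hend b k h2 hb' ha').elim
  · rcases hb.cases_head with rfl | ⟨_, ⟨k, rfl⟩, h2⟩
    · exact (hend a j h1 ha' hb').elim
    · by_cases hjk : j = k
      · subst hjk
        have := hstep a j h1 ha'
        exact expands_unique U (t.expand j) a b h1 h2 ha' hb'
      · have hsub : Sub ((t.expand j).expand (skip j k)).right U := by
          have s1 := sub_of_expands h1
          have s2 := sub_of_expands h2
          rw [ha'] at s1
          rw [hb'] at s2
          have hj := j.2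
          have hk := k.2
          have ht := t.right_leaves
          rcases lt_or_gt_of_ne (fun e => hjk (Fin.ext e) : (j : ℕ) ≠ k) with h | h
          · have := Sub.addCaret_addCaret h (by omega) s1 s2
            have e : (skip j k : ℕ) = k + 1 := if_neg (by omega)
            rwa [← e] at this
          · have := Sub.addCaret_addCaret h (by omega) s2 s1
            have e : (skip k j : ℕ) = j + 1 := if_neg (by omega)
            rw [t.expand_expand hjk]
            rwa [← e] at this
        obtain ⟨d, hd, hd'⟩ := exists_expands U _ hsub
        have := hstep a j h1 ha'
        have := hstep b k h2 hb'
        have e1 := expands_unique U (t.expand j) a d h1 (.head ⟨_, _root_.rfl⟩ hd) ha' hd'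
        have e2 := expands_unique U (t.expand k) b d h2
          (.head ⟨_, t.expand_expand hjk⟩ hd) hb' hd'
        rw [e1, e2]
termination_by U.numLeaves - t.right.numLeaves

/-! ### The group structure -/

theorem Comp.expand {a b c : Triple} (h : Comp a b c) (k : Fin b.n) :
    ∃ (k' : Fin a.n) (k'' : Fin c.n),
      Comp (a.expand k') (b.expand k) (c.expand k'') ∧ (k' : ℕ) = rho b.braid k ∧
        (k'' : ℕ) = k := by
  cases h with
  | mk n l m r hl hm hr β γ =>
    refine ⟨rho γ k, k, ?_, _root_.rfl, _root_.rfl⟩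
    have := Comp.mk (n + 1) (addCaret l (rho β (rho γ k))) (addCaret m (rho γ k))
      (addCaret r k) (by rw [numLeaves_addCaret, hl]) (by rw [numLeaves_addCaret, hm])
      (by rw [numLeaves_addCaret, hr]) (bifurcate (rho γ k) β) (bifurcate k γ)
    simpa only [Triple.expand, bifurcate_mul, map_mul, Equiv.Perm.mul_apply] using this

theorem Comp.expands_left {a b c a' : Triple} (h : Comp a b c) (ha : Expands a a') :
    ∃ b' c', Expands b b' ∧ Expands c c' ∧ Comp a' b' c' := by
  obtain ⟨j, rfl⟩ := ha
  have hn : a.n = b.n := by cases h; exact _root_.rfl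
  obtain ⟨k, hk⟩ := (rho b.braid).surjective (Fin.cast hn j)
  obtain ⟨k', k'', h1, h2, -⟩ := h.expand k
  have : k' = j := Fin.ext (by rw [h2, hk]; exact _root_.rfl)
  subst this
  exact ⟨_, _, ⟨_, _root_.rfl⟩, ⟨_, _root_.rfl⟩, h1⟩

theorem Comp.expands_mid {a b c b' : Triple} (h : Comp a b c) (hb : Expands b b') :
    ∃ a' c', Expands a a' ∧ Expands c c' ∧ Comp a' b' c' := by
  obtain ⟨j, rfl⟩ := hb
  obtain ⟨k', k'', h1, -, -⟩ := h.expand j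
  exact ⟨_, _, ⟨_, _root_.rfl⟩, ⟨_, _root_.rfl⟩, h1⟩

theorem Comp.expands_right {a b c c' : Triple} (h : Comp a b c) (hc : Expands c c') :
    ∃ a' b', Expands a a' ∧ Expands b b' ∧ Comp a' b' c' := by
  obtain ⟨j, rfl⟩ := hc
  have hn : c.n = b.n := by cases h; exact _root_.rfl
  obtain ⟨k', k'', h1, -, h2⟩ := h.expand (Fin.cast hn j)
  have : k'' = j := Fin.ext (by rw [h2]; exact _root_.rfl)
  subst this
  exact ⟨_, _, ⟨_, _root_.rfl⟩, ⟨_, _root_.rfl⟩, h1⟩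

section

open Relation

theorem Comp.trans_left {a b c a' : Triple} (h : Comp a b c) (ha : ReflTransGen Expands a a') :
    ∃ b' c', ReflTransGen Expands b b' ∧ ReflTransGen Expands c c' ∧ Comp a' b' c' := by
  induction ha with
  | refl => exact ⟨b, c, .refl, .refl, h⟩
  | tail _ hs ih =>
    obtain ⟨b', c', h1, h2, h3⟩ := ih
    obtain ⟨b'', c'', h4, h5, h6⟩ := h3.expands_left hs
    exact ⟨b'', c'', h1.tail h4, h2.tail h5, h6⟩

theorem Comp.trans_mid {a b c b' : Triple} (h : Comp a b c) (hb : ReflTransGen Expands b b') :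
    ∃ a' c', ReflTransGen Expands a a' ∧ ReflTransGen Expands c c' ∧ Comp a' b' c' := by
  induction hb with
  | refl => exact ⟨a, c, .refl, .refl, h⟩
  | tail _ hs ih =>
    obtain ⟨b', c', h1, h2, h3⟩ := ih
    obtain ⟨b'', c'', h4, h5, h6⟩ := h3.expands_mid hs
    exact ⟨b'', c'', h1.tail h4, h2.tail h5, h6⟩

theorem Comp.trans_right {a b c c' : Triple} (h : Comp a b c) (hc : ReflTransGen Expands c c') :
    ∃ a' b', ReflTransGen Expands a a' ∧ ReflTransGen Expands b b' ∧ Comp a' b' c' := by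
  induction hc with
  | refl => exact ⟨a, b, .refl, .refl, h⟩
  | tail _ hs ih =>
    obtain ⟨b', c', h1, h2, h3⟩ := ih
    obtain ⟨b'', c'', h4, h5, h6⟩ := h3.expands_right hs
    exact ⟨b'', c'', h1.tail h4, h2.tail h5, h6⟩

theorem Comp.right_eq_left {a b c : Triple} (h : Comp a b c) : a.right = b.left := by
  cases h; exact _root_.rfl

theorem Comp.right_eq_right {a b c : Triple} (h : Comp a b c) : c.right = b.right := by
  cases h; exact _root_.rfl

theorem Comp.exists_of_eq {a b : Triple} (h : a.right = b.left) : ∃ c, Comp a b c := by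
  obtain ⟨n, l, m, hl, hm, β⟩ := a
  obtain ⟨n', m', r, hm', hr, γ⟩ := b
  obtain rfl : m = m' := h
  obtain rfl : n = n' := hm.symm.trans hm'
  exact ⟨_, Comp.mk n l m r hl hm hr β γ⟩

theorem Comp.det {a b c c' : Triple} (h : Comp a b c) (h' : Comp a b c') : c = c' := by
  cases h; cases h'; exact _root_.rfl

theorem Comp.assoc {a b c ab bc abc abc' : Triple} (h1 : Comp a b ab) (h2 : Comp ab c abc)
    (h3 : Comp b c bc) (h4 : Comp a bc abc') : abc = abc' := by
  cases h1; cases h2; cases h3; cases h4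
  rw [mul_assoc]

/-- The product of classes does not depend on the choice of representatives. -/
theorem Comp.wellDefined {a b c a₁ b₁ c₁ : Triple} (h : Comp a b c) (h₁ : Comp a₁ b₁ c₁)
    (ha : a.toBV = a₁.toBV) (hb : b.toBV = b₁.toBV) : c.toBV = c₁.toBV := by
  obtain ⟨A, hA, hA₁⟩ := toBV_eq_iff.1 ha
  obtain ⟨B, C, hB, hC, hABC⟩ := h.trans_left hA
  obtain ⟨B₁, C₁, hB₁, hC₁, hABC₁⟩ := h₁.trans_left hA₁
  obtain ⟨D, hD, hD₁⟩ := toBV_eq_iff.1 ((toBV_eq hB).symm.trans (hb.trans (toBV_eq hB₁)))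
  obtain ⟨A', C', hA', hC', h'⟩ := hABC.trans_mid hD
  obtain ⟨A'', C'', hA'', hC'', h''⟩ := hABC₁.trans_mid hD₁
  have e : A' = A'' := expands_unique D.left A A' A'' hA' hA'' h'.right_eq_left h''.right_eq_left
  subst e
  have e : C' = C'' := h'.det h''
  subst e
  exact (toBV_eq (hC.trans hC')).trans (toBV_eq (hC₁.trans hC'')).symm

/-- The triple `(T₊, β⁻¹, T₋)`. -/
def Triple.inv (t : Triple) : Triple :=
  ⟨t.n, t.right, t.left, t.right_leaves, t.left_leaves, t.braid⁻¹⟩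

theorem Triple.inv_inv (t : Triple) : t.inv.inv = t := by
  obtain ⟨n, l, r, hl, hr, β⟩ := t
  exact congrArg (Triple.mk n l r hl hr) (_root_.inv_inv β)

theorem Triple.inv_expand (t : Triple) (k : Fin t.n) :
    (t.expand k).inv = t.inv.expand (rho t.braid k) := by
  obtain ⟨n, l, r, hl, hr, β⟩ := t
  change Fin n at k
  have e1 : rho β⁻¹ (rho β k) = k := by simp
  have e2 := bifurcate_inv k β
  simp only [Triple.inv, Triple.expand, Triple.mk.injEq, heq_eq_eq, true_and]
  exact ⟨(congrArg (fun x : Fin n => addCaret r x) e1).symm, e2.symm⟩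

theorem expands_inv {a b : Triple} (h : ReflTransGen Expands a b) :
    ReflTransGen Expands a.inv b.inv := by
  induction h with
  | refl => exact .refl
  | tail _ hs ih =>
    obtain ⟨k, rfl⟩ := hs
    exact ih.tail ⟨_, Triple.inv_expand _ k⟩

/-- Up to expansions, any two triples can be composed. -/
theorem exists_comp (a b : Triple) : ∃ a' b' c', ReflTransGen Expands a a' ∧
    ReflTransGen Expands b b' ∧ Comp a' b' c' := by
  obtain ⟨W, h1, h2⟩ := exists_sub_sub a.right b.left
  obtain ⟨a', ha, ha'⟩ := exists_expands W a h1
  obtain ⟨b', hb, hb'⟩ := exists_expands W b.inv h2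
  have hb2 := expands_inv hb
  rw [Triple.inv_inv] at hb2
  obtain ⟨c, hc⟩ := Comp.exists_of_eq (a := a') (b := b'.inv) (ha'.trans hb'.symm)
  exact ⟨a', b'.inv, c, ha, hb2, hc⟩

end

theorem exists_mul (x y : BV) : ∃ z : BV, ∃ a b c : Triple,
    Comp a b c ∧ a.toBV = x ∧ b.toBV = y ∧ c.toBV = z := by
  obtain ⟨a, rfl⟩ := x.exists_rep
  obtain ⟨b, rfl⟩ := y.exists_rep
  obtain ⟨a', b', c', ha, hb, hc⟩ := exists_comp a b
  exact ⟨_, a', b', c', hc, (toBV_eq ha).symm, (toBV_eq hb).symm, _root_.rfl⟩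

/-- The product on `bV`: it is the (unique) operation with
`[T₋, β, T] * [T, γ, T₊] = [T₋, β * γ, T₊]`; see `Comp.toBV_mul`. -/
noncomputable instance : Mul BV := ⟨fun x y => (exists_mul x y).choose⟩

theorem Comp.toBV_mul {a b c : Triple} (h : Comp a b c) : a.toBV * b.toBV = c.toBV := by
  obtain ⟨a', b', c', h', ha, hb, hc⟩ := (exists_mul a.toBV b.toBV).choose_spec
  exact hc.symm.trans (h'.wellDefined h ha hb)

/-- The identity of `bV` is the class of `(T, 1, T)` for the one-leaf tree `T`. -/
instance : One BV := ⟨Triple.toBV ⟨1, .nil, .nil, by simp, by simp, 1⟩⟩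

/-- The inverse of `[T₋, β, T₊]` is `[T₊, β⁻¹, T₋]`. -/
instance : Inv BV := ⟨fun x => Quotient.liftOn x (fun t => t.inv.toBV) (fun a b h => by
  obtain ⟨c, h1, h2⟩ := toBV_eq_iff.1 (Quotient.sound h)
  exact toBV_eq_iff.2 ⟨c.inv, expands_inv h1, expands_inv h2⟩)⟩

theorem Triple.toBV_inv (t : Triple) : t.toBV⁻¹ = t.inv.toBV := _root_.rfl

theorem toBV_one {n : ℕ} (T : PTree) (h h' : T.numLeaves = n) :
    Triple.toBV ⟨n, T, T, h, h', 1⟩ = 1 := by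
  obtain ⟨t, ht, ht'⟩ := exists_expands T ⟨1, .nil, .nil, by simp, by simp, 1⟩ trivial
  have key : t.left = t.right ∧ t.braid = 1 := by
    clear ht'
    induction ht with
    | refl => exact ⟨_root_.rfl, _root_.rfl⟩
    | tail _ hs ih =>
      obtain ⟨k, rfl⟩ := hs
      obtain ⟨h1, h2⟩ := ih
      simp only [Triple.expand, h1, h2, bifurcate_one, map_one, Equiv.Perm.one_apply, true_and]
      exact _root_.rfl
  have e := toBV_eq ht
  obtain ⟨m, l, r, hl, hr, β⟩ := t
  obtain ⟨h1, h2⟩ := key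
  obtain rfl : l = r := h1
  obtain rfl : β = 1 := h2
  obtain rfl : l = T := ht'
  subst hl
  subst h
  exact e.symm

/-- The braided Thompson group `bV`. -/
noncomputable instance : Group BV :=
  Group.ofLeftAxioms
    (by
      intro x y z
      obtain ⟨w, a, b, ab, h1, rfl, rfl, rfl⟩ := exists_mul x y
      obtain ⟨c, rfl⟩ := z.exists_rep
      obtain ⟨ab', c', abc, hab, hc, h2⟩ := exists_comp ab c
      obtain ⟨a', b', ha, hb, h3⟩ := h1.trans_right hab
      obtain ⟨bc, h4⟩ := Comp.exists_of_eq (h3.right_eq_right.symm.trans h2.right_eq_left)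
      have h5' : a'.right = bc.left := by
        rw [h3.right_eq_left]; cases h4; exact _root_.rfl
      obtain ⟨abc', h5⟩ := Comp.exists_of_eq h5'
      rw [toBV_eq ha, toBV_eq hb, toBV_eq hc, h3.toBV_mul, h2.toBV_mul, h4.toBV_mul, h5.toBV_mul,
        Comp.assoc h3 h2 h4 h5])
    (by
      intro x
      obtain ⟨⟨n, l, r, hl, hr, β⟩, rfl⟩ := x.exists_rep
      have := (Comp.mk n l l r hl hl hr 1 β).toBV_mul
      rwa [toBV_one, one_mul] at this)
    (by
      intro x
      obtain ⟨⟨n, l, r, hl, hr, β⟩, rfl⟩ := x.exists_rep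
      have := (Comp.mk n r l r hr hl hr β⁻¹ β).toBV_mul
      rwa [inv_mul_cancel, toBV_one] at this)

/-! ### The subgroup `\widehat{bV}` and quasimorphisms -/

/-- The standard copy of `B_{n-1}` inside `B_n`, which only braids the first `n - 1` strands. -/
def hatBraid (n : ℕ) : Subgroup (Braid n) :=
  Subgroup.closure {β | ∃ i : ℕ, i + 2 < n ∧ β = sigma n i}

theorem sigma_mem_hatBraid {n i : ℕ} (h : i + 2 < n) : sigma n i ∈ hatBraid n :=
  Subgroup.subset_closure ⟨i, h, _root_.rfl⟩

theorem bifurcate_mem_hatBraid {n : ℕ} {β : Braid n} (h : β ∈ hatBraid n) :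
    ∀ k, bifurcate k β ∈ hatBraid (n + 1) := by
  induction h using Subgroup.closure_induction with
  | mem x hx =>
    obtain ⟨i, hi, rfl⟩ := hx
    intro k
    have h1 := sigma_mem_hatBraid (n := n + 1) (i := i) (by omega)
    have h2 := sigma_mem_hatBraid (n := n + 1) (i := i + 1) (by omega)
    rw [bifurcate_sigma (by omega), genBif]
    split_ifs
    exacts [h2, mul_mem h1 h2, mul_mem h2 h1, h1]
  | one => intro k; rw [bifurcate_one]; exact one_mem _
  | mul x y _ _ hx hy => intro k; rw [bifurcate_mul]; exact mul_mem (hx _) (hy _)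
  | inv x _ hx =>
    intro k
    obtain ⟨k, rfl⟩ := (rho x).surjective k
    rw [bifurcate_inv]
    exact inv_mem (hx _)

theorem expands_mem_hatBraid {a b : Triple} (h : Relation.ReflTransGen Expands a b)
    (ha : a.braid ∈ hatBraid a.n) : b.braid ∈ hatBraid b.n := by
  induction h with
  | refl => exact ha
  | tail _ hs ih =>
    obtain ⟨k, rfl⟩ := hs
    exact bifurcate_mem_hatBraid ih k

/-- The subgroup `\widehat{bV}` of `bV`, consisting of the classes `[T₋, β, T₊]` for which `β` only
braids the first `n - 1` strands. -/
def bVhat : Subgroup BV where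
  carrier := {x | ∃ t : Triple, t.toBV = x ∧ t.braid ∈ hatBraid t.n}
  mul_mem' := by
    rintro _ _ ⟨a, rfl, ha⟩ ⟨b, rfl, hb⟩
    obtain ⟨a', b', c', h1, h2, h3⟩ := exists_comp a b
    refine ⟨c', by rw [toBV_eq h1, toBV_eq h2, h3.toBV_mul], ?_⟩
    have ha' := expands_mem_hatBraid h1 ha
    have hb' := expands_mem_hatBraid h2 hb
    cases h3
    exact mul_mem ha' hb'
  one_mem' := ⟨_, _root_.rfl, one_mem _⟩
  inv_mem' := by
    rintro _ ⟨a, rfl, ha⟩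
    exact ⟨a.inv, _root_.rfl, (hatBraid a.n).inv_mem ha⟩

/-- A quasimorphism on a group: `|q(g) + q(h) - q(gh)|` is uniformly bounded. -/
def IsQuasimorphism {G : Type*} [Group G] (q : G → ℝ) : Prop :=
  ∃ D : ℝ, ∀ g h : G, |q g + q h - q (g * h)| ≤ D

end BraidedThompson

/-! The two assertions have separate proofs.

The statement on factorisations follows from an unbounded quasimorphism on `BV` that is bounded on
`bVhat`: it is then uniformly bounded on conjugates of elements of `bVhat`, so its value on a
product is at most linear in the number of factors. This quasimorphism is a twisting number. The
elements of the free group are the lifts of a boundary base point of the punctured disc to its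
universal cover, and as such carry a cyclic order `Cyc`, read off from the planar Cayley tree. The
Artin action preserves it (`cyc_artinRep`) and fixes the boundary word `bd n`. Cut open at the
powers of `bd n`, it becomes a linear order of the non-peripheral elements on which `bd n` acts as a
translation, and `twist` is, up to orientation, an integer part of the position in this order. An
order automorphism that commutes with the translation changes differences of integer parts by at
most one (`abs_twist_artinRep_le`). Bifurcation acts through `cab`, which keeps twisting numbers
exactly (`twist_cab`); hence the twisting number of the image of the last generator descends to `BV`
up to a bounded error, however many expansions are made. Braids in `hatBraid` fix the last
generator, whereas the powers of the full twist in `Braid 2` twist arbitrarily often.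

For the first assertion, replace the quasimorphism by its homogenisation `φ`. The endomorphism
`inLeft` lets `BV` act on the left half; its image commutes with a conjugate of itself, acting on
the right half, and `inLeft` composed with itself is conjugate to `inLeft`. Two commuting copies
side by side double the failure of additivity, so `φ` is additive along `inLeft`
(`map_mul_of_commuting_conjugate`), hence zero there, since `BV` has no non-zero homomorphism to the
reals (`additive_eq_zero`). An element of `bVhat` with trivial germ at the last leaf is conjugate
into the image of `inLeft`. Any other element of `bVhat` acquires trivial germ on multiplication by
a power of one fixed element that is itself conjugate into that image; so `φ` is bounded on `bVhat`
by its defect. -/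

namespace BraidedThompson

/-! ### Directions and cyclic order in the Cayley tree of a free group. -/

/-! ### The planar cyclic order on a free group -/

/-- The direction in which a reduced word leaves the identity vertex of the Cayley tree; the
directions at a vertex are numbered counterclockwise, and `0` is the direction of the boundary. -/
def first (w : FreeGroup ℕ) : ℕ :=
  match w.toWord.head? with
  | none => 0
  | some (i, true) => 2 * i + 1
  | some (i, false) => 2 * i + 2

theorem first_one : first 1 = 0 := by simp [first]

theorem first_eq_zero {w : FreeGroup ℕ} : first w = 0 ↔ w = 1 := by
  rw [← FreeGroup.toWord_eq_nil_iff, first]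
  rcases w.toWord with _ | ⟨⟨i, _ | _⟩, L⟩ <;> simp

theorem first_eq_of_toWord {w : FreeGroup ℕ} {i : ℕ} {b : Bool} {L : List (ℕ × Bool)}
    (h : w.toWord = (i, b) :: L) : first w = if b then 2 * i + 1 else 2 * i + 2 := by
  rw [first, h]; cases b <;> simp

theorem toWord_cons (i : ℕ) (b : Bool) (w : FreeGroup ℕ) :
    (FreeGroup.mk [(i, b)] * w).toWord =
      if w.toWord.head? = some (i, !b) then w.toWord.tail else (i, b) :: w.toWord := by
  rw [FreeGroup.toWord_mul, FreeGroup.toWord_mk, FreeGroup.reduce_singleton, List.singleton_append,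
    FreeGroup.reduce.cons, FreeGroup.reduce_toWord]
  rcases w.toWord with _ | ⟨⟨j, c⟩, L⟩
  · simp
  · rcases b <;> rcases c <;> simp [eq_comm]

theorem head?_eq_iff {w : FreeGroup ℕ} {i : ℕ} {b : Bool} :
    w.toWord.head? = some (i, b) ↔ first w = if b then 2 * i + 1 else 2 * i + 2 := by
  rw [first]
  rcases w.toWord with _ | ⟨⟨j, _ | _⟩, L⟩ <;> rcases b with _ | _ <;> simp <;> omega

/-- A new letter either cancels against its inverse at the front of `w` or becomes the first letter.
After a cancellation it cannot reappear in front, because `w` was reduced. -/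
theorem first_cons {i : ℕ} {b : Bool} {w : FreeGroup ℕ} :
    first (FreeGroup.mk [(i, b)] * w) = (if b then 2 * i + 1 else 2 * i + 2) ↔
      first w ≠ if b then 2 * i + 2 else 2 * i + 1 := by
  rw [← head?_eq_iff, toWord_cons]
  have h : w.toWord.head? = some (i, !b) ↔ first w = if b then 2 * i + 2 else 2 * i + 1 := by
    rw [head?_eq_iff]; cases b <;> simp
  rw [Ne, ← h]
  split_ifs with h1
  · refine iff_of_false (fun h2 => ?_) (not_not.2 h1)
    have hr : FreeGroup.IsReduced w.toWord := FreeGroup.isReduced_toWord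
    rcases hw : w.toWord with _ | ⟨x, _ | ⟨y, L⟩⟩
    · simp [hw] at h1
    · simp [hw] at h2
    · rw [hw] at h1 h2 hr
      simp only [List.head?_cons, List.tail_cons, Option.some.injEq] at h1 h2
      subst h1 h2
      have := (FreeGroup.isReduced_cons_cons.1 hr).1 rfl
      cases b <;> simp at this
  · exact iff_of_true (by simp) h1

theorem first_of_mul {i : ℕ} {w : FreeGroup ℕ} :
    first (FreeGroup.of i * w) = 2 * i + 1 ↔ first w ≠ 2 * i + 2 :=
  first_cons (b := true)

theorem first_inv_mul {i : ℕ} {w : FreeGroup ℕ} :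
    first ((FreeGroup.of i)⁻¹ * w) = 2 * i + 2 ↔ first w ≠ 2 * i + 1 :=
  first_cons (b := false)

theorem first_of (i : ℕ) : first (FreeGroup.of i) = 2 * i + 1 := by
  simpa [first_one] using (first_of_mul (i := i) (w := 1))

theorem first_of_inv (i : ℕ) : first (FreeGroup.of i)⁻¹ = 2 * i + 2 := by
  simpa [first_one] using (first_inv_mul (i := i) (w := 1))

/-- Induction on reduced words. -/
theorem reduced_induction {P : FreeGroup ℕ → Prop} (h1 : P 1)
    (hof : ∀ i w, first w ≠ 2 * i + 2 → P w → P (FreeGroup.of i * w))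
    (hinv : ∀ i w, first w ≠ 2 * i + 1 → P w → P ((FreeGroup.of i)⁻¹ * w)) (w : FreeGroup ℕ) :
    P w := by
  induction hn : w.toWord.length generalizing w with
  | zero =>
    rw [List.length_eq_zero_iff, FreeGroup.toWord_eq_nil_iff] at hn
    exact hn ▸ h1
  | succ n ih =>
    rcases hw : w.toWord with _ | ⟨⟨i, b⟩, L⟩
    · simp [hw] at hn
    · have hf := first_eq_of_toWord hw
      have key : (FreeGroup.mk [(i, !b)] * w).toWord = L := by rw [toWord_cons, hw]; simp
      have hl : L.length = n := by simpa [hw] using hn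
      have hP := ih _ (key ▸ hl)
      cases b
      · have e : w = (FreeGroup.of i)⁻¹ * (FreeGroup.of i * w) := by group
        rw [e]
        refine hinv i _ (fun h => ?_) hP
        exact first_of_mul.1 h hf
      · have e : w = FreeGroup.of i * ((FreeGroup.of i)⁻¹ * w) := by group
        rw [e]
        refine hof i _ (fun h => ?_) hP
        exact first_inv_mul.1 h hf

/-- Two vertices of a tree other than `1` and `w` cannot both lie beyond the other one. -/
theorem first_inv_mul_of_ne (w : FreeGroup ℕ) : ∀ p, w ≠ 1 → first p ≠ first w →
    first (w⁻¹ * p) = first w⁻¹ := by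
  induction w using reduced_induction with
  | h1 => simp
  | hof i w hw ih =>
    intro p _ hp
    rw [first_of_mul.2 hw] at hp
    rw [mul_inv_rev, mul_assoc]
    by_cases h : w = 1
    · subst h; simpa [first_of_inv] using first_inv_mul.2 hp
    · rw [ih _ h (by rw [first_inv_mul.2 hp]; exact hw.symm),
        ih _ h (by rw [first_of_inv]; exact hw.symm)]
  | hinv i w hw ih =>
    intro p _ hp
    rw [first_inv_mul.2 hw] at hp
    rw [mul_inv_rev, mul_assoc, inv_inv]
    by_cases h : w = 1
    · subst h; simpa [first_of] using first_of_mul.2 hp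
    · rw [ih _ h (by rw [first_of_mul.2 hp]; exact hw.symm),
        ih _ h (by rw [first_of]; exact hw.symm)]

/-- If the path from `v` to `p` avoids the branch of `w`, then the path from `w` to `p` runs through
`v`. This is all that `median_unique` and `Cyc.trans` need to know about the tree. -/
theorem first_tree {v w : FreeGroup ℕ} (h : v ≠ w) (p : FreeGroup ℕ) :
    first (v⁻¹ * p) = first (v⁻¹ * w) ∨ first (w⁻¹ * p) = first (w⁻¹ * v) := by
  by_contra! hc
  have := first_inv_mul_of_ne (v⁻¹ * w) (v⁻¹ * p) (by simpa [inv_mul_eq_one] using h) hc.1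
  apply hc.2
  simpa [mul_assoc] using this

/-- The cyclic order on `ℕ`. -/
def cyc (a b c : ℕ) : Prop := (a < b ∧ b < c) ∨ (b < c ∧ c < a) ∨ (c < a ∧ a < b)

/-- The cyclic order on the vertices of the Cayley tree, seen from the boundary. -/
def Cyc (p q r : FreeGroup ℕ) : Prop :=
  ∃ v : FreeGroup ℕ, cyc (first (v⁻¹ * p)) (first (v⁻¹ * q)) (first (v⁻¹ * r))

theorem Cyc.rot {p q r : FreeGroup ℕ} (h : Cyc p q r) : Cyc q r p := by
  obtain ⟨v, h⟩ := h
  exact ⟨v, by unfold cyc at *; omega⟩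

theorem Cyc.mul_left {p q r : FreeGroup ℕ} (h : Cyc p q r) (g : FreeGroup ℕ) :
    Cyc (g * p) (g * q) (g * r) := by
  obtain ⟨v, h⟩ := h
  exact ⟨g * v, by simpa [mul_assoc] using h⟩

theorem Cyc.of_first {p q r : FreeGroup ℕ} (h : cyc (first p) (first q) (first r)) :
    Cyc p q r := ⟨1, by simpa using h⟩

/-- Pigeonhole: for distinct `v`, `w`, each of the three points lies in the branch at `v` towards
`w` or in the branch at `w` towards `v`, so two of them share a direction. -/
theorem median_unique {v w p q r : FreeGroup ℕ}
    (h1 : first (v⁻¹ * p) ≠ first (v⁻¹ * q)) (h2 : first (v⁻¹ * q) ≠ first (v⁻¹ * r))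
    (h3 : first (v⁻¹ * r) ≠ first (v⁻¹ * p))
    (k1 : first (w⁻¹ * p) ≠ first (w⁻¹ * q)) (k2 : first (w⁻¹ * q) ≠ first (w⁻¹ * r))
    (k3 : first (w⁻¹ * r) ≠ first (w⁻¹ * p)) : v = w := by
  by_contra h
  rcases first_tree h p with a | a <;> rcases first_tree h q with b | b <;>
    rcases first_tree h r with c | c <;> omega

theorem Cyc.asymm {p q r : FreeGroup ℕ} (h : Cyc p q r) (h' : Cyc p r q) : False := by
  obtain ⟨v, h⟩ := h
  obtain ⟨w, h'⟩ := h'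
  unfold cyc at *
  obtain rfl : v = w := median_unique (p := p) (q := q) (r := r) (by omega) (by omega) (by omega)
    (by omega) (by omega) (by omega)
  omega

/-- If the two medians differ, `first_tree` leaves sixteen configurations; each is either impossible
or has one of the two medians as a witness for the conclusion. -/
theorem Cyc.trans {p q r s : FreeGroup ℕ} (h : Cyc p q r) (h' : Cyc p r s) : Cyc p q s := by
  obtain ⟨v, h⟩ := h
  obtain ⟨w, h'⟩ := h'
  by_cases hvw : v = w
  · subst hvw; exact ⟨v, by unfold cyc at *; omega⟩
  rcases first_tree hvw p with a | a <;> rcases first_tree hvw q with b | b <;>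
    rcases first_tree hvw r with c | c <;> rcases first_tree hvw s with d | d <;>
    first
    | (exfalso; unfold cyc at *; omega)
    | exact ⟨v, by unfold cyc at *; omega⟩
    | exact ⟨w, by unfold cyc at *; omega⟩

/-- The median is found by following `q` from `1` as long as `r` takes the same edge. The third
point `m` is arbitrary, subject to lying in another direction, so that it can be translated along in
the induction. -/
theorem exists_median (q : FreeGroup ℕ) : ∀ r m, q ≠ r → first q ≠ first m →
    first r ≠ first m → ∃ v : FreeGroup ℕ, first (v⁻¹ * q) ≠ first (v⁻¹ * r) ∧
      first (v⁻¹ * q) ≠ first (v⁻¹ * m) ∧ first (v⁻¹ * r) ≠ first (v⁻¹ * m) := by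
  induction q using reduced_induction with
  | h1 =>
    exact fun r m h h1 h2 => ⟨1, by simpa [first_one, eq_comm, first_eq_zero] using h,
      by simpa using h1, by simpa using h2⟩
  | hof i q hq ih =>
    intro r m h h1 h2
    rw [first_of_mul.2 hq] at h1
    by_cases hr : first r = 2 * i + 1
    · obtain ⟨v, hv⟩ := ih ((FreeGroup.of i)⁻¹ * r) ((FreeGroup.of i)⁻¹ * m)
        (fun e => h (by rw [e]; group)) (by rwa [first_inv_mul.2 h1.symm])
        (by rw [first_inv_mul.2 h1.symm]; exact fun h => first_inv_mul.1 h hr)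
      exact ⟨FreeGroup.of i * v, by simpa [mul_assoc] using hv⟩
    · exact ⟨1, by simpa [first_of_mul.2 hq, eq_comm] using ⟨hr, h1.symm, h2⟩⟩
  | hinv i q hq ih =>
    intro r m h h1 h2
    rw [first_inv_mul.2 hq] at h1
    by_cases hr : first r = 2 * i + 2
    · obtain ⟨v, hv⟩ := ih (FreeGroup.of i * r) (FreeGroup.of i * m)
        (fun e => h (by rw [e]; group)) (by rwa [first_of_mul.2 h1.symm])
        (by rw [first_of_mul.2 h1.symm]; exact fun h => first_of_mul.1 h hr)
      exact ⟨(FreeGroup.of i)⁻¹ * v, by simpa [mul_assoc] using hv⟩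
    · exact ⟨1, by simpa [first_inv_mul.2 hq, eq_comm] using ⟨hr, h1.symm, h2⟩⟩

theorem Cyc.total {p q r : FreeGroup ℕ} (h1 : p ≠ q) (h2 : q ≠ r) (h3 : r ≠ p) :
    Cyc p q r ∨ Cyc p r q := by
  -- Translation by `p⁻¹` moves `p` to `1`, whose direction `0` differs from that of every other
  -- vertex.
  obtain ⟨v, hv⟩ := exists_median (p⁻¹ * q) (p⁻¹ * r) 1 (by simpa using h2)
    (by rw [first_one, Ne, first_eq_zero, inv_mul_eq_one]; exact h1)
    (by rw [first_one, Ne, first_eq_zero, inv_mul_eq_one]; exact h3.symm)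
  have : cyc (first ((p * v)⁻¹ * p)) (first ((p * v)⁻¹ * q)) (first ((p * v)⁻¹ * r)) ∨
      cyc (first ((p * v)⁻¹ * p)) (first ((p * v)⁻¹ * r)) (first ((p * v)⁻¹ * q)) := by
    simp only [mul_inv_rev, mul_assoc, inv_mul_cancel] at hv ⊢
    unfold cyc
    omega
  exact this.imp (fun h => ⟨_, h⟩) (fun h => ⟨_, h⟩)

/-- A ping-pong criterion for a homomorphism to preserve the cyclic order. -/
theorem Cyc.map_of_cones {f : FreeGroup ℕ →* FreeGroup ℕ} (J : ℕ → FreeGroup ℕ → Prop)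
    (hf : ∀ w, J (first w) (f w))
    (hJ : ∀ a b c p q r, cyc a b c → J a p → J b q → J c r → Cyc p q r)
    {p q r : FreeGroup ℕ} (h : Cyc p q r) : Cyc (f p) (f q) (f r) := by
  obtain ⟨v, h⟩ := h
  have := (hJ _ _ _ _ _ _ h (hf _) (hf _) (hf _)).mul_left (f v)
  simpa using this

end BraidedThompson

/-! ### The Artin representation: compatibility with bifurcation, invariance of the cyclic order. -/

namespace BraidedThompson

/-! ### The Artin action -/

/-- The Artin endomorphism `x_i ↦ x_i x_{i+1} x_i⁻¹`, `x_{i+1} ↦ x_i`. -/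
def artinHom (i : ℕ) : FreeGroup ℕ →* FreeGroup ℕ :=
  FreeGroup.lift fun j =>
    if j = i then FreeGroup.of i * FreeGroup.of (i + 1) * (FreeGroup.of i)⁻¹
    else if j = i + 1 then FreeGroup.of i else FreeGroup.of j

theorem artinHom_self (i : ℕ) : artinHom i (FreeGroup.of i) =
    FreeGroup.of i * FreeGroup.of (i + 1) * (FreeGroup.of i)⁻¹ := by
  simp [artinHom]

theorem artinHom_succ (i : ℕ) : artinHom i (FreeGroup.of (i + 1)) = FreeGroup.of i := by
  simp [artinHom]

theorem artinHom_of_ne {i j : ℕ} (h : j ≠ i) (h' : j ≠ i + 1) :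
    artinHom i (FreeGroup.of j) = FreeGroup.of j := by
  simp [artinHom, h, h']

/-- The inverse of `artinHom i`. -/
def artinInvHom (i : ℕ) : FreeGroup ℕ →* FreeGroup ℕ :=
  FreeGroup.lift fun j =>
    if j = i then FreeGroup.of (i + 1)
    else if j = i + 1 then (FreeGroup.of (i + 1))⁻¹ * FreeGroup.of i * FreeGroup.of (i + 1)
    else FreeGroup.of j

/-- The Artin automorphism `x_i ↦ x_i x_{i+1} x_i⁻¹`, `x_{i+1} ↦ x_i`. -/
def artin (i : ℕ) : MulAut (FreeGroup ℕ) :=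
  MonoidHom.toMulEquiv (artinHom i) (artinInvHom i)
    (FreeGroup.ext_hom _ _ fun j => by
      by_cases h : j = i
      · subst h; simp [artinHom, artinInvHom]; group
      · by_cases h' : j = i + 1
        · subst h'; simp [artinHom, artinInvHom]
        · simp [artinHom, artinInvHom, h, h'])
    (FreeGroup.ext_hom _ _ fun j => by
      by_cases h : j = i
      · subst h; simp [artinHom, artinInvHom]
      · by_cases h' : j = i + 1
        · subst h'; simp [artinHom, artinInvHom]; group
        · simp [artinHom, artinInvHom, h, h'])

theorem artin_apply (i : ℕ) (w : FreeGroup ℕ) : artin i w = artinHom i w := rfl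

theorem mulAut_ext {f g : MulAut (FreeGroup ℕ)}
    (h : ∀ j, f (FreeGroup.of j) = g (FreeGroup.of j)) : f = g := by
  have : f.toMonoidHom = g.toMonoidHom := FreeGroup.ext_hom _ _ h
  ext w
  exact DFunLike.congr_fun this w

/-- The Artin representation; the strand in position `k` corresponds to the free generator `k`. -/
def artinRep (n : ℕ) : Braid n →* MulAut (FreeGroup ℕ) :=
  PresentedGroup.toGroup (f := fun i : Fin (n - 1) => artin i) (by
    rintro r (⟨i, j, h, rfl⟩ | ⟨i, j, h, rfl⟩)
    · simp only [map_mul, map_inv, FreeGroup.lift_apply_of, mul_inv_eq_one]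
      generalize (i : ℕ) = i, (j : ℕ) = j at h
      refine mulAut_ext fun k => ?_
      simp only [MulAut.mul_apply, artin_apply]
      rcases (by omega : k = i ∨ k = i + 1 ∨ k = j ∨ k = j + 1 ∨
        (k ≠ i ∧ k ≠ i + 1 ∧ k ≠ j ∧ k ≠ j + 1)) with rfl | rfl | rfl | rfl | hk <;>
      simp (disch := omega) only [map_mul, map_inv, artinHom_self, artinHom_succ, artinHom_of_ne]
    · simp only [map_mul, map_inv, FreeGroup.lift_apply_of, mul_inv_eq_one]
      rw [← h]
      generalize (i : ℕ) = i
      refine mulAut_ext fun k => ?_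
      simp only [MulAut.mul_apply, artin_apply]
      rcases (by omega : k = i ∨ k = i + 1 ∨ k = i + 1 + 1 ∨
        (k ≠ i ∧ k ≠ i + 1 ∧ k ≠ i + 1 + 1)) with rfl | rfl | rfl | hk <;>
      simp (disch := omega) only [map_mul, map_inv, artinHom_self, artinHom_succ, artinHom_of_ne]
        <;> group)

theorem artinRep_of {n : ℕ} (i : Fin (n - 1)) (w : FreeGroup ℕ) :
    artinRep n (PresentedGroup.of i) w = artinHom i w := by
  simp [artinRep, artin_apply]

theorem artinRep_sigma {n i : ℕ} (h : i + 1 < n) (w : FreeGroup ℕ) :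
    artinRep n (sigma n i) w = artinHom i w := by
  rw [sigma, dif_pos (by omega), artinRep_of]

/-- The endomorphism of the free group corresponding to the bifurcation of the strand `k`. -/
def cab (k : ℕ) : FreeGroup ℕ →* FreeGroup ℕ :=
  FreeGroup.lift fun j =>
    if j < k then FreeGroup.of j
    else if j = k then FreeGroup.of k * FreeGroup.of (k + 1) else FreeGroup.of (j + 1)

theorem cab_lt {j k : ℕ} (h : j < k) : cab k (FreeGroup.of j) = FreeGroup.of j := by
  simp [cab, h]

theorem cab_self (k : ℕ) : cab k (FreeGroup.of k) = FreeGroup.of k * FreeGroup.of (k + 1) := by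
  simp [cab]

theorem cab_gt {j k : ℕ} (h : k < j) : cab k (FreeGroup.of j) = FreeGroup.of (j + 1) := by
  simp [cab, h.ne', h.not_gt]

/-- Bifurcating a strand replaces the loop around its puncture by the product of the loops around
two new punctures, so `cab` intertwines the actions. It suffices to compare on free generators, for
each position of `k` relative to the crossing. -/
theorem artinRep_genBif {n i k : ℕ} (hi : i + 1 < n) (w : FreeGroup ℕ) :
    artinRep (n + 1) (genBif n i k) (cab k w) = cab (natSwap i k) (artinHom i w) := by
  suffices h : ((artinRep (n + 1) (genBif n i k)).toMonoidHom).comp (cab k) =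
      (cab (natSwap i k)).comp (artinHom i) from DFunLike.congr_fun h w
  refine FreeGroup.ext_hom _ _ fun j => ?_
  simp only [MonoidHom.comp_apply, MulEquiv.toMonoidHom_eq_coe, MonoidHom.coe_coe]
  rcases (by omega : k < i ∨ k = i ∨ k = i + 1 ∨ i + 1 < k) with h | rfl | rfl | h
  · rw [genBif_lt n h, natSwap_lt h, artinRep_sigma (by omega)]
    rcases (by omega : j = i ∨ j = i + 1 ∨ (j ≠ i ∧ j ≠ i + 1)) with rfl | rfl | hj
    · simp (disch := omega) only [cab_gt, artinHom_self, map_mul, map_inv]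
    · simp (disch := omega) only [cab_gt, artinHom_succ]
    · rcases lt_trichotomy j k with h' | rfl | h' <;>
      simp (disch := omega) only [cab_lt, cab_gt, cab_self, artinHom_of_ne, map_mul]
  · rw [genBif_self, natSwap_self, map_mul, MulAut.mul_apply, artinRep_sigma (by omega),
      artinRep_sigma (by omega)]
    rcases (by omega : j = k ∨ j = k + 1 ∨ j < k ∨ k + 1 < j) with rfl | rfl | hj | hj <;>
    simp (disch := omega) only [cab_lt, cab_gt, cab_self, artinHom_of_ne, artinHom_self,
      artinHom_succ, map_mul, map_inv]
    group
  · rw [genBif_succ, natSwap_succ, map_mul, MulAut.mul_apply, artinRep_sigma (by omega),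
      artinRep_sigma (by omega)]
    rcases (by omega : j = i ∨ j = i + 1 ∨ j < i ∨ i + 1 < j) with rfl | rfl | hj | hj <;>
    simp (disch := omega) only [cab_lt, cab_gt, cab_self, artinHom_of_ne, artinHom_self,
      artinHom_succ, map_mul, map_inv]
    group
  · rw [genBif_gt n h, natSwap_gt h, artinRep_sigma (by omega)]
    rcases (by omega : j = i ∨ j = i + 1 ∨ (j ≠ i ∧ j ≠ i + 1)) with rfl | rfl | hj
    · simp (disch := omega) only [cab_lt, artinHom_self, map_mul, map_inv]
    · simp (disch := omega) only [cab_lt, artinHom_succ]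
    · rcases lt_trichotomy j k with h' | rfl | h' <;>
      simp (disch := omega) only [cab_lt, cab_gt, cab_self, artinHom_of_ne, map_mul]

/-- Bifurcating a strand of a braid is compatible with the Artin representation. -/
theorem artinRep_bifurcate {n : ℕ} (β : Braid n) : ∀ (k : Fin n) (w : FreeGroup ℕ),
    artinRep (n + 1) (bifurcate k β) (cab k w) = cab (rho β k) (artinRep n β w) := by
  induction β using braid_induction with
  | h1 => simp [bifurcate_one]
  | hof i =>
    intro k w
    have := i.2
    rw [bifurcate_of, rho_of, genPerm_val, artinRep_of, artinRep_genBif (by omega)]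
  | hmul β γ hβ hγ =>
    intro k w
    rw [bifurcate_mul, map_mul, map_mul, map_mul, MulAut.mul_apply, hγ, hβ]
    rfl
  | hinv β hβ =>
    intro k w
    obtain ⟨k, rfl⟩ := (rho β).surjective k
    obtain ⟨w, rfl⟩ := (artinRep n β).surjective w
    rw [bifurcate_inv, ← hβ, ← MulAut.mul_apply, ← MulAut.mul_apply, ← map_mul, ← map_mul]
    simp

/-! ### The Artin action preserves the cyclic order -/

/-- The edge from `1` to `FreeGroup.of i` separates the tree; the alternatives are its two sides. -/
theorem first_inv_of_mul_self {i : ℕ} (w : FreeGroup ℕ) :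
    (first w = 2 * i + 1 ∧ first ((FreeGroup.of i)⁻¹ * w) ≠ 2 * i + 2) ∨
      (first w ≠ 2 * i + 1 ∧ first ((FreeGroup.of i)⁻¹ * w) = 2 * i + 2) := by
  have := first_inv_mul (i := i) (w := w)
  by_cases h : first w = 2 * i + 1
  · exact Or.inl ⟨h, fun h' => this.1 h' h⟩
  · exact Or.inr ⟨h, this.2 h⟩

/-- The image of the cone of words leaving in direction `c` under `artinHom i` lies in this set. -/
def artinCone (i c : ℕ) (w : FreeGroup ℕ) : Prop :=
  if c = 2 * i + 1 then first w = 2 * i + 1 ∧ first ((FreeGroup.of i)⁻¹ * w) = 2 * i + 3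
  else if c = 2 * i + 2 then first w = 2 * i + 1 ∧ first ((FreeGroup.of i)⁻¹ * w) = 2 * i + 4
  else if c = 2 * i + 3 then first w = 2 * i + 1 ∧ first ((FreeGroup.of i)⁻¹ * w) ≠ 2 * i + 3 ∧
    first ((FreeGroup.of i)⁻¹ * w) ≠ 2 * i + 4
  else if c = 2 * i + 4 then first w = 2 * i + 2 ∨ first w = 2 * i + 3 ∨ first w = 2 * i + 4
  else first w = c

/-- When a letter is prepended, the cone of the rest of the word controls the cancellation. The
image of a letter can cancel entirely only for the inverse of `x_{i+1}`, which is why the cone of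
that direction comprises three directions. -/
theorem artinCone_first (i : ℕ) (w : FreeGroup ℕ) :
    artinCone i (first w) (artinHom i w) := by
  induction w using reduced_induction with
  | h1 => simp [artinCone, first_one]
  | hof j w hw ih =>
    rw [first_of_mul.2 hw, map_mul]
    have hA := first_inv_of_mul_self (i := i) (artinHom i w)
    rcases (by omega : j = i ∨ j = i + 1 ∨ (j ≠ i ∧ j ≠ i + 1)) with rfl | rfl | hj
    · have h1 : first ((FreeGroup.of j)⁻¹ * artinHom j w) ≠ 2 * (j + 1) + 2 := by
        unfold artinCone at ih; split_ifs at ih <;> omega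
      have h2 := first_of_mul.2 h1
      have h3 : first (FreeGroup.of j * (FreeGroup.of (j + 1) *
          ((FreeGroup.of j)⁻¹ * artinHom j w))) = 2 * j + 1 := first_of_mul.2 (by omega)
      rw [artinHom_self, artinCone, if_pos rfl, mul_assoc, mul_assoc, inv_mul_cancel_left]
      exact ⟨h3, h2⟩
    · have h1 : first (artinHom i w) ≠ 2 * i + 2 ∧ first (artinHom i w) ≠ 2 * i + 3 ∧
          first (artinHom i w) ≠ 2 * i + 4 := by
        unfold artinCone at ih; split_ifs at ih <;> omega
      rw [artinHom_succ, artinCone, if_neg (by omega), if_neg (by omega), if_pos (by omega),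
        inv_mul_cancel_left]
      exact ⟨first_of_mul.2 h1.1, h1.2⟩
    · rw [artinHom_of_ne hj.1 hj.2, artinCone, if_neg (by omega), if_neg (by omega),
        if_neg (by omega), if_neg (by omega)]
      refine first_of_mul.2 ?_
      unfold artinCone at ih; split_ifs at ih <;> omega
  | hinv j w hw ih =>
    rw [first_inv_mul.2 hw, map_mul, map_inv]
    have hA := first_inv_of_mul_self (i := i) (artinHom i w)
    rcases (by omega : j = i ∨ j = i + 1 ∨ (j ≠ i ∧ j ≠ i + 1)) with rfl | rfl | hj
    · have h1 : first ((FreeGroup.of j)⁻¹ * artinHom j w) ≠ 2 * (j + 1) + 1 := by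
        unfold artinCone at ih; split_ifs at ih <;> omega
      have h2 := first_inv_mul.2 h1
      have h3 : first (FreeGroup.of j * ((FreeGroup.of (j + 1))⁻¹ *
          ((FreeGroup.of j)⁻¹ * artinHom j w))) = 2 * j + 1 := first_of_mul.2 (by omega)
      rw [artinHom_self, artinCone, if_neg (by omega), if_pos rfl, mul_inv_rev, mul_inv_rev,
        inv_inv, mul_assoc, mul_assoc, inv_mul_cancel_left]
      exact ⟨h3, h2⟩
    · rw [artinHom_succ, artinCone, if_neg (by omega), if_neg (by omega), if_neg (by omega),
        if_pos (by omega)]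
      unfold artinCone at ih; split_ifs at ih <;> omega
    · rw [artinHom_of_ne hj.1 hj.2, artinCone, if_neg (by omega), if_neg (by omega),
        if_neg (by omega), if_neg (by omega)]
      refine first_inv_mul.2 ?_
      unfold artinCone at ih; split_ifs at ih <;> omega

/-- Three of the cones leave `1` in the direction `2 * i + 1`. They are compared at the next vertex
`FreeGroup.of i`, from which `1` is seen in direction `2 * i + 2`. -/
theorem artinCone_mono {i a b : ℕ} {p q : FreeGroup ℕ} (h : a < b)
    (hp : artinCone i a p) (hq : artinCone i b q) :
    first p < first q ∨ (first p = 2 * i + 1 ∧ first q = 2 * i + 1 ∧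
      cyc (2 * i + 2) (first ((FreeGroup.of i)⁻¹ * p)) (first ((FreeGroup.of i)⁻¹ * q))) := by
  have hp' := first_inv_of_mul_self (i := i) p
  have hq' := first_inv_of_mul_self (i := i) q
  unfold artinCone at hp hq
  generalize first p = A, first q = A', first ((FreeGroup.of i)⁻¹ * p) = B,
    first ((FreeGroup.of i)⁻¹ * q) = B' at *
  unfold cyc
  split_ifs at hp <;> split_ifs at hq <;> omega

theorem Cyc.of_artinCone {i a b c : ℕ} {p q r : FreeGroup ℕ} (h : cyc a b c)
    (hp : artinCone i a p) (hq : artinCone i b q) (hr : artinCone i c r) : Cyc p q r := by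
  have key : ∀ a b c p q r, (a < b ∧ b < c) → artinCone i a p → artinCone i b q →
      artinCone i c r → Cyc p q r := by
    clear h hp hq hr
    intro a b c p q r h hp hq hr
    have h1 := artinCone_mono h.1 hp hq
    have h2 := artinCone_mono h.2 hq hr
    have hp' := first_inv_of_mul_self (i := i) p
    have hr' := first_inv_of_mul_self (i := i) r
    by_cases hd : first p < first q ∧ first q < first r
    · exact Cyc.of_first (Or.inl hd)
    · refine ⟨FreeGroup.of i, ?_⟩
      unfold cyc at *
      omega
  rcases h with h | h | h
  · exact key _ _ _ _ _ _ h hp hq hr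
  · exact (key _ _ _ _ _ _ h hq hr hp).rot.rot
  · exact (key _ _ _ _ _ _ h hr hp hq).rot

theorem Cyc.artinHom {p q r : FreeGroup ℕ} (h : Cyc p q r) (i : ℕ) :
    Cyc (artinHom i p) (artinHom i q) (artinHom i r) :=
  h.map_of_cones (artinCone i) (artinCone_first i) fun _ _ _ _ _ _ => Cyc.of_artinCone

theorem Cyc.ne {p q r : FreeGroup ℕ} (h : Cyc p q r) : p ≠ q := by
  rintro rfl
  obtain ⟨v, h⟩ := h
  unfold cyc at h
  omega

/-- For a generator the converse follows from totality: if `p`, `q`, `r` had the opposite order, so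
would their images. -/
theorem cyc_artinRep {n : ℕ} (β : Braid n) : ∀ p q r : FreeGroup ℕ,
    Cyc (artinRep n β p) (artinRep n β q) (artinRep n β r) ↔ Cyc p q r := by
  induction β using braid_induction with
  | h1 => simp
  | hof i =>
    intro p q r
    simp only [artinRep_of]
    refine ⟨fun h => ?_, fun h => h.artinHom i⟩
    rcases Cyc.total (p := p) (q := q) (r := r) (fun e => h.ne (by rw [e]))
      (fun e => h.rot.ne (by rw [e])) (fun e => h.rot.rot.ne (by rw [e])) with h' | h'
    · exact h'
    · exact (h.asymm (h'.artinHom i)).elim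
  | hmul β γ hβ hγ => intro p q r; simp only [map_mul, MulAut.mul_apply, hβ, hγ]
  | hinv β hβ =>
    intro p q r
    rw [← hβ]
    simp only [map_inv, MulAut.apply_inv_self]

end BraidedThompson

/-! ### Twisting numbers of words, and their behaviour under bifurcations and braids. -/

namespace BraidedThompson

/-! ### The boundary word and the twisting number -/

/-- The word `x_0 x_1 ⋯ x_{n-1}` representing the boundary of the disc with `n` punctures. -/
def bd : ℕ → FreeGroup ℕ
  | 0 => 1
  | n + 1 => bd n * FreeGroup.of n

/-- The product of the generators `i` and `i + 1` is fixed, so only the partial product that ends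
between them changes. -/
theorem artinHom_bd (i j : ℕ) : artinHom i (bd j) =
    if j = i + 1 then bd i * (FreeGroup.of i * FreeGroup.of (i + 1) * (FreeGroup.of i)⁻¹)
    else bd j := by
  induction j with
  | zero => simp [bd]
  | succ j ih =>
    rw [bd, map_mul, ih]
    rcases (by omega : j = i ∨ j = i + 1 ∨ (j ≠ i ∧ j ≠ i + 1)) with rfl | rfl | hj
    · rw [if_neg (by omega), if_pos rfl, artinHom_self]
    · rw [if_pos rfl, if_neg (by omega), artinHom_succ, bd]; group
    · rw [if_neg (by omega), if_neg (by omega), artinHom_of_ne hj.1 hj.2]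

theorem artinRep_bd {n : ℕ} (β : Braid n) : artinRep n β (bd n) = bd n := by
  induction β using braid_induction with
  | h1 => simp
  | hof i => have := i.2; rw [artinRep_of, artinHom_bd, if_neg (by omega)]
  | hmul β γ hβ hγ => rw [map_mul, MulAut.mul_apply, hγ, hβ]
  | hinv β hβ =>
    nth_rw 1 [← hβ]
    rw [map_inv, MulAut.inv_apply_self]

/-- This is why the twisting of a triple is measured on the last generator: it then vanishes on
`hatBraid`. -/
theorem artinRep_last {n : ℕ} {β : Braid n} (h : β ∈ hatBraid n) :
    artinRep n β (FreeGroup.of (n - 1)) = FreeGroup.of (n - 1) := by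
  induction h using Subgroup.closure_induction with
  | mem x hx =>
    obtain ⟨i, hi, rfl⟩ := hx
    rw [artinRep_sigma (by omega), artinHom_of_ne (by omega) (by omega)]
  | one => simp
  | mul x y _ _ hx hy => rw [map_mul, MulAut.mul_apply, hy, hx]
  | inv x _ hx =>
    nth_rw 1 [← hx]
    rw [map_inv, MulAut.inv_apply_self]

/-- The free group on the first `n` generators. -/
def freeSub (n : ℕ) : Subgroup (FreeGroup ℕ) :=
  Subgroup.closure {w | ∃ j < n, w = FreeGroup.of j}

theorem of_mem_freeSub {j n : ℕ} (h : j < n) : FreeGroup.of j ∈ freeSub n :=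
  Subgroup.subset_closure ⟨j, h, rfl⟩

theorem freeSub_letters {n : ℕ} {w : FreeGroup ℕ} (h : w ∈ freeSub n) :
    ∀ x ∈ w.toWord, x.1 < n := by
  induction h using Subgroup.closure_induction with
  | mem x hx => obtain ⟨j, hj, rfl⟩ := hx; simpa using hj
  | one => simp
  | mul x y _ _ hx hy =>
    intro z hz
    rcases List.mem_append.1 ((FreeGroup.toWord_mul_sublist x y).subset hz) with h | h
    exacts [hx z h, hy z h]
  | inv x _ hx =>
    intro z hz
    rw [FreeGroup.toWord_inv] at hz
    simp only [FreeGroup.invRev, List.mem_reverse, List.mem_map] at hz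
    obtain ⟨y, hy, rfl⟩ := hz
    exact hx y hy

theorem first_le_of_mem_freeSub {n : ℕ} {w : FreeGroup ℕ} (h : w ∈ freeSub n) :
    first w ≤ 2 * n := by
  have := freeSub_letters h
  rw [first]
  rcases hw : w.toWord with _ | ⟨⟨i, _ | _⟩, L⟩
  · simp
  all_goals
    rw [hw] at this
    have := this _ List.mem_cons_self
    simp only [List.head?_cons]
    dsimp only at this
    omega

theorem map_mem_freeSub {m n : ℕ} {f : FreeGroup ℕ →* FreeGroup ℕ}
    (hf : ∀ j < m, f (FreeGroup.of j) ∈ freeSub n) {w : FreeGroup ℕ} (h : w ∈ freeSub m) :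
    f w ∈ freeSub n := by
  induction h using Subgroup.closure_induction with
  | mem x hx => obtain ⟨j, hj, rfl⟩ := hx; exact hf j hj
  | one => rw [map_one]; exact one_mem _
  | mul x y _ _ hx hy => rw [map_mul]; exact mul_mem hx hy
  | inv x _ hx => rw [map_inv]; exact inv_mem hx

theorem artinHom_mem_freeSub {n i : ℕ} (hi : i + 1 < n) {w : FreeGroup ℕ} (h : w ∈ freeSub n) :
    artinHom i w ∈ freeSub n := by
  refine map_mem_freeSub (fun j hj => ?_) h
  have h1 := of_mem_freeSub (n := n) (j := i) (by omega)
  have h2 := of_mem_freeSub (n := n) (j := i + 1) (by omega)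
  have h3 := of_mem_freeSub hj
  simp only [artinHom, FreeGroup.lift_apply_of]
  split_ifs
  exacts [mul_mem (mul_mem h1 h2) (inv_mem h1), h1, h3]

theorem artinInvHom_mem_freeSub {n i : ℕ} (hi : i + 1 < n) {w : FreeGroup ℕ}
    (h : w ∈ freeSub n) : artinInvHom i w ∈ freeSub n := by
  refine map_mem_freeSub (fun j hj => ?_) h
  have h1 := of_mem_freeSub (n := n) (j := i) (by omega)
  have h2 := of_mem_freeSub (n := n) (j := i + 1) (by omega)
  have h3 := of_mem_freeSub hj
  simp only [artinInvHom, FreeGroup.lift_apply_of]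
  split_ifs
  exacts [h2, mul_mem (mul_mem (inv_mem h2) h1) h2, h3]

theorem artinRep_mem_freeSub {n : ℕ} (β : Braid n) : ∀ w : FreeGroup ℕ,
    artinRep n β w ∈ freeSub n ↔ w ∈ freeSub n := by
  induction β using braid_induction with
  | h1 => simp
  | hof i =>
    intro w
    have := i.2
    rw [artinRep_of]
    refine ⟨fun h => ?_, artinHom_mem_freeSub (by omega)⟩
    have h' := artinInvHom_mem_freeSub (i := i) (by omega) h
    rwa [show artinInvHom i (artinHom i w) = w from (artin i).symm_apply_apply w] at h'
  | hmul β γ hβ hγ => intro w; rw [map_mul, MulAut.mul_apply, hβ, hγ]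
  | hinv β hβ =>
    intro w
    rw [← hβ, map_inv, MulAut.apply_inv_self]

theorem cab_mem_freeSub {n k : ℕ} {w : FreeGroup ℕ} (h : w ∈ freeSub n) :
    cab k w ∈ freeSub (n + 1) := by
  refine map_mem_freeSub (fun j hj => ?_) h
  simp only [cab, FreeGroup.lift_apply_of]
  split_ifs
  · exact of_mem_freeSub (by omega)
  · exact mul_mem (of_mem_freeSub (by omega)) (of_mem_freeSub (by omega))
  · exact of_mem_freeSub (by omega)

theorem bd_mem_freeSub {m n : ℕ} (h : m ≤ n) : bd m ∈ freeSub n := by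
  induction m with
  | zero => exact one_mem _
  | succ m ih => exact mul_mem (ih (by omega)) (of_mem_freeSub (by omega))

theorem first_bd_inv (n : ℕ) : first (bd n)⁻¹ = 2 * n := by
  induction n with
  | zero => simp [bd, first_one]
  | succ n ih => rw [bd, mul_inv_rev, first_inv_mul.2 (by omega)]; ring

/-- The reduced word of `w` starts with the boundary word of length `n`. -/
def Pre (n : ℕ) (w : FreeGroup ℕ) : Prop := first ((bd n)⁻¹ * w) ≠ 2 * n

theorem first_of_Pre {n : ℕ} {w : FreeGroup ℕ} (h : Pre n w) :
    ∀ j < n, first ((bd j)⁻¹ * w) = 2 * j + 1 := by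
  induction n with
  | zero => simp
  | succ n ih =>
    have h1 : first ((bd n)⁻¹ * w) = 2 * n + 1 := by
      by_contra hc
      apply h
      rw [bd, mul_inv_rev, mul_assoc, first_inv_mul.2 hc]
      ring
    intro j hj
    rcases (by omega : j < n ∨ j = n) with h' | rfl
    · exact ih (by rw [Pre, h1]; omega) j h'
    · exact h1

theorem Pre_iff {n : ℕ} (hn : 1 ≤ n) {w : FreeGroup ℕ} :
    Pre n w ↔ ∀ j < n, first ((bd j)⁻¹ * w) = 2 * j + 1 := by
  refine ⟨first_of_Pre, fun h => ?_⟩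
  obtain ⟨m, rfl⟩ : ∃ m, n = m + 1 := ⟨n - 1, by omega⟩
  have h1 := h m (by omega)
  rw [Pre, bd, mul_inv_rev, mul_assoc]
  exact fun h2 => first_inv_mul.1 h2 h1

/-- Follow the boundary word up to the vertex `bd j` where `w` leaves it. From there `1` is seen in
direction `2 * j` and `y` in direction `2 * j + 1`. These are neighbours, so any third direction
completes them to the right cyclic order. -/
theorem Cyc.of_Pre {n : ℕ} (hn : 1 ≤ n) {y w : FreeGroup ℕ} (hy : Pre n y) (hw : ¬ Pre n w)
    (h1 : w ≠ 1) : Cyc 1 y w := by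
  classical
  have hex : ∃ j, j < n ∧ first ((bd j)⁻¹ * w) ≠ 2 * j + 1 := by
    rw [Pre_iff hn] at hw
    push Not at hw
    exact hw
  obtain ⟨hj, hc⟩ := Nat.find_spec hex
  have hmin := fun m => Nat.find_min hex (m := m)
  generalize Nat.find hex = j at *
  have h2 : first ((bd j)⁻¹ * w) ≠ 2 * j := by
    cases j with
    | zero => simpa [bd, first_eq_zero] using h1
    | succ j =>
      have h3 := hmin j (by omega)
      rw [bd, mul_inv_rev, mul_assoc]
      intro h4
      exact h3 ⟨by omega, first_inv_mul.1 (h4.trans (by ring))⟩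
  refine ⟨bd j, ?_⟩
  rw [mul_one, first_bd_inv, first_of_Pre hy j hj]
  unfold cyc
  omega

theorem Pre_bd {n : ℕ} (hn : 1 ≤ n) : Pre n (bd n) := by
  rw [Pre, inv_mul_cancel, first_one]; omega

theorem first_eq_one_of_Pre {n : ℕ} (hn : 1 ≤ n) {u : FreeGroup ℕ} (h : Pre n u) :
    first u = 1 := by
  simpa [bd] using first_of_Pre h 0 hn

theorem Pre_bd_mul {n : ℕ} {u : FreeGroup ℕ} : Pre n (bd n * u) ↔ first u ≠ 2 * n := by
  rw [Pre, inv_mul_cancel_left]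

theorem Pre.bd_mul {n : ℕ} (hn : 1 ≤ n) {u : FreeGroup ℕ} (h : Pre n u) : Pre n (bd n * u) := by
  rw [Pre_bd_mul, first_eq_one_of_Pre hn h]; omega

theorem first_mul_letter {l : FreeGroup ℕ} {i : ℕ}
    (hl : l = FreeGroup.of i ∨ l = (FreeGroup.of i)⁻¹) (u : FreeGroup ℕ) :
    u ≠ 1 → u * l = 1 ∨ first (u * l) = first u := by
  induction u using reduced_induction with
  | h1 => simp
  | hof j w hw ih =>
    intro _
    rw [first_of_mul.2 hw]
    by_cases h : w = 1
    · subst h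
      rw [mul_one]
      by_cases h' : first l = 2 * j + 2
      · rcases hl with rfl | rfl
        · rw [first_of] at h'; omega
        · rw [first_of_inv] at h'
          obtain rfl : i = j := by omega
          simp
      · exact Or.inr (first_of_mul.2 h')
    · rw [mul_assoc]
      refine Or.inr (first_of_mul.2 ?_)
      rcases ih h with h' | h'
      · rw [h', first_one]; omega
      · rwa [h']
  | hinv j w hw ih =>
    intro _
    rw [first_inv_mul.2 hw]
    by_cases h : w = 1
    · subst h
      rw [mul_one]
      by_cases h' : first l = 2 * j + 1
      · rcases hl with rfl | rfl
        · rw [first_of] at h'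
          obtain rfl : i = j := by omega
          simp
        · rw [first_of_inv] at h'; omega
      · exact Or.inr (first_inv_mul.2 h')
    · rw [mul_assoc]
      refine Or.inr (first_inv_mul.2 ?_)
      rcases ih h with h' | h'
      · rw [h', first_one]; omega
      · rwa [h']

/-- One additional boundary word on the left makes up for any cancellation caused by one letter on
the right. Hence every word starts with the boundary word after multiplication by a large power of
it, and does not for a very negative power. -/
theorem Pre.bd_mul_letter {n i : ℕ} (hn : 1 ≤ n) {u l : FreeGroup ℕ}
    (hl : l = FreeGroup.of i ∨ l = (FreeGroup.of i)⁻¹) (h : Pre n u) : Pre n (bd n * (u * l)) := by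
  have h1 := first_eq_one_of_Pre hn h
  rw [Pre_bd_mul]
  rcases first_mul_letter hl u (fun e => by rw [e, first_one] at h1; omega) with h2 | h2
  · rw [h2, first_one]; omega
  · rw [h2, h1]; omega

/-- A property of elements preserved by right multiplication with letters holds everywhere. -/
theorem right_induction {P : FreeGroup ℕ → Prop} (h1 : P 1)
    (h : ∀ i w l, (l = FreeGroup.of i ∨ l = (FreeGroup.of i)⁻¹) → P w → P (w * l))
    (w : FreeGroup ℕ) : P w := by
  suffices ∀ v, P v → P (v * w) by simpa using this 1 h1
  induction w using reduced_induction with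
  | h1 => simp
  | hof i w _ ih => intro v hv; rw [← mul_assoc]; exact ih _ (h i v _ (Or.inl rfl) hv)
  | hinv i w _ ih => intro v hv; rw [← mul_assoc]; exact ih _ (h i v _ (Or.inr rfl) hv)

theorem exists_Pre {n : ℕ} (hn : 1 ≤ n) (w : FreeGroup ℕ) : ∃ k : ℤ, Pre n (bd n ^ k * w) := by
  induction w using right_induction with
  | h1 => exact ⟨1, by simpa using Pre_bd hn⟩
  | h i w l hl ih =>
    obtain ⟨k, hk⟩ := ih
    refine ⟨1 + k, ?_⟩
    rw [zpow_add, zpow_one, mul_assoc, ← mul_assoc (bd n ^ k)]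
    exact hk.bd_mul_letter hn hl

theorem exists_not_Pre {n : ℕ} (hn : 1 ≤ n) (w : FreeGroup ℕ) :
    ∃ k : ℤ, ¬ Pre n (bd n ^ k * w) := by
  induction w using right_induction with
  | h1 => exact ⟨0, by simp [Pre, first_bd_inv]⟩
  | h i w l hl ih =>
    obtain ⟨k, hk⟩ := ih
    refine ⟨k - 1, fun h => hk ?_⟩
    have := h.bd_mul_letter hn (l := l⁻¹) (i := i) (by
      rcases hl with rfl | rfl
      · exact Or.inr rfl
      · exact Or.inl (inv_inv _))
    rwa [mul_assoc, mul_inv_cancel_right, ← mul_assoc, ← zpow_one_add, add_sub_cancel] at this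

theorem Pre.zpow_mono {n : ℕ} (hn : 1 ≤ n) {j k : ℤ} {w : FreeGroup ℕ} (hjk : j ≤ k)
    (h : Pre n (bd n ^ j * w)) : Pre n (bd n ^ k * w) := by
  induction k, hjk using Int.leInduction with
  | base => exact h
  | succ k _ ih =>
    rw [add_comm, zpow_add, zpow_one, mul_assoc]
    exact ih.bd_mul hn

/-- The exponents `j` satisfying the condition form a non-empty set of integers, closed downwards
and bounded above; `e` is its maximum plus one. For `n = 0` the value is a dummy. -/
theorem exists_twist (n : ℕ) (w : FreeGroup ℕ) :
    ∃ e : ℤ, 1 ≤ n → ∀ j : ℤ, Pre n (bd n ^ (-j) * w) ↔ j < e := by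
  by_cases hn : 1 ≤ n
  swap
  · exact ⟨0, fun h => absurd h hn⟩
  obtain ⟨k, hk⟩ := exists_Pre hn w
  obtain ⟨l, hl⟩ := exists_not_Pre hn w
  obtain ⟨m, hm, hmax⟩ := Int.exists_greatest_of_bdd (P := fun j : ℤ => Pre n (bd n ^ (-j) * w))
    ⟨-l, fun z hz => by
      by_contra hc
      exact hl (hz.zpow_mono hn (by omega))⟩ ⟨-k, by simpa using hk⟩
  refine ⟨m + 1, fun _ j => ⟨fun h => ?_, fun h => hm.zpow_mono hn (by omega)⟩⟩
  have := hmax j h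
  omega

/-- The twisting number of `w`: the exponent of the largest power of the boundary word with which
`w` starts. -/
noncomputable def twist (n : ℕ) (w : FreeGroup ℕ) : ℤ := (exists_twist n w).choose

theorem Pre_zpow_iff {n : ℕ} (hn : 1 ≤ n) (w : FreeGroup ℕ) (j : ℤ) :
    Pre n (bd n ^ (-j) * w) ↔ j < twist n w :=
  (exists_twist n w).choose_spec hn j

theorem twist_congr {m n : ℕ} (hm : 1 ≤ m) (hn : 1 ≤ n) {v w : FreeGroup ℕ} (d : ℤ)
    (h : ∀ j : ℤ, Pre m (bd m ^ (-(j + d)) * v) ↔ Pre n (bd n ^ (-j) * w)) :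
    twist m v = twist n w + d := by
  simp only [Pre_zpow_iff hm, Pre_zpow_iff hn] at h
  have h1 := h (twist n w)
  have h2 := h (twist n w - 1)
  omega

theorem twist_zpow_mul {n : ℕ} (hn : 1 ≤ n) (k : ℤ) (w : FreeGroup ℕ) :
    twist n (bd n ^ k * w) = twist n w + k :=
  twist_congr hn hn k fun j => by rw [← mul_assoc, ← zpow_add, neg_add, neg_add_cancel_right]

theorem twist_eq_zero {n : ℕ} (hn : 1 ≤ n) {w : FreeGroup ℕ} (h1 : first w ≠ 1)
    (h2 : first w ≠ 2 * n) : twist n w = 0 := by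
  have h3 := Pre_zpow_iff hn w 0
  have h4 := Pre_zpow_iff hn w (-1)
  rw [neg_neg, zpow_one, Pre_bd_mul] at h4
  rw [neg_zero, zpow_zero, one_mul] at h3
  have h5 := h4.1 h2
  have h6 : ¬ (0 < twist n w) := fun h => h1 (first_eq_one_of_Pre hn (h3.2 h))
  omega

/-! ### Bifurcation does not change twisting numbers -/

/-- Bifurcation inserts the directions `2 * k + 2` and `2 * k + 3` between the two ends of the
`k`-th loop: its image starts with `x_k`, and the inverse of its image starts with the inverse of
`x_{k+1}`. No cancellation occurs. -/
theorem first_cab (k : ℕ) (w : FreeGroup ℕ) :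
    first (cab k w) = if first w ≤ 2 * k + 1 then first w else first w + 2 := by
  induction w using reduced_induction with
  | h1 => simp [first_one]
  | hof j w hw ih =>
    rw [first_of_mul.2 hw, map_mul]
    rcases lt_trichotomy j k with h | rfl | h
    · rw [cab_lt h, if_pos (by omega), first_of_mul, ih]
      split_ifs <;> omega
    · have h1 : first (FreeGroup.of (j + 1) * cab j w) = 2 * (j + 1) + 1 := by
        rw [first_of_mul, ih]
        split_ifs <;> omega
      rw [cab_self, if_pos le_rfl, mul_assoc, first_of_mul]
      omega
    · have h1 : first (FreeGroup.of (j + 1) * cab k w) = 2 * (j + 1) + 1 := by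
        rw [first_of_mul, ih]
        split_ifs <;> omega
      rw [cab_gt h, if_neg (by omega), h1]; ring
  | hinv j w hw ih =>
    rw [first_inv_mul.2 hw, map_mul, map_inv]
    rcases lt_trichotomy j k with h | rfl | h
    · rw [cab_lt h, if_pos (by omega), first_inv_mul, ih]
      split_ifs <;> omega
    · have h1 : first ((FreeGroup.of j)⁻¹ * cab j w) = 2 * j + 2 := by
        rw [first_inv_mul, ih]
        split_ifs <;> omega
      have h2 : first ((FreeGroup.of (j + 1))⁻¹ * ((FreeGroup.of j)⁻¹ * cab j w)) =
          2 * (j + 1) + 2 := first_inv_mul.2 (by omega)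
      rw [cab_self, if_neg (by omega), mul_inv_rev, mul_assoc, h2]; ring
    · have h1 : first ((FreeGroup.of (j + 1))⁻¹ * cab k w) = 2 * (j + 1) + 2 := by
        rw [first_inv_mul, ih]
        split_ifs <;> omega
      rw [cab_gt h, if_neg (by omega), h1]; ring

theorem cab_injective (k : ℕ) : Function.Injective (cab k) := by
  refine (injective_iff_map_eq_one _).2 fun w hw => ?_
  have := first_cab k w
  rw [hw, first_one] at this
  rw [← first_eq_zero]
  split_ifs at this <;> omega

theorem cab_bd (k j : ℕ) : cab k (bd j) = if j ≤ k then bd j else bd (j + 1) := by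
  induction j with
  | zero => simp [bd]
  | succ j ih =>
    rw [bd, map_mul, ih]
    rcases lt_trichotomy j k with h | rfl | h
    · rw [if_pos (by omega), if_pos (by omega), cab_lt h]
    · rw [if_pos le_rfl, if_neg (by omega), cab_self, bd, bd, mul_assoc]
    · rw [if_neg (by omega), if_neg (by omega), cab_gt h]; rfl

/-- Since `cab k` maps boundary word to boundary word and the direction `2 * n` to `2 * (n + 1)`,
there is no error term, and iterated expansions accumulate none. -/
theorem twist_cab {n k : ℕ} (hk : k < n) (w : FreeGroup ℕ) :
    twist (n + 1) (cab k w) = twist n w := by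
  have hb : cab k (bd n) = bd (n + 1) := by rw [cab_bd, if_neg (by omega)]
  rw [← add_zero (twist n w)]
  refine twist_congr (by omega) (by omega) 0 fun j => ?_
  rw [add_zero, ← hb, ← map_zpow, ← map_mul, Pre, Pre, ← hb, ← map_inv, ← map_mul, first_cab]
  split_ifs <;> omega

/-! ### Braids almost preserve differences of twisting numbers -/

/-- The elements of the free group which are not powers of the boundary word. -/
def NonPeripheral (n : ℕ) (w : FreeGroup ℕ) : Prop :=
  w ∈ freeSub n ∧ ∀ k : ℤ, w ≠ bd n ^ k

theorem NonPeripheral.zpow_mul {n : ℕ} {w : FreeGroup ℕ} (h : NonPeripheral n w) (j : ℤ) :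
    NonPeripheral n (bd n ^ j * w) := by
  refine ⟨mul_mem (zpow_mem (bd_mem_freeSub le_rfl) j) h.1, fun k e => h.2 (k - j) ?_⟩
  rw [zpow_sub, ← zpow_neg, ← zpow_add, add_comm, zpow_add, ← e, ← mul_assoc, ← zpow_add]
  simp

theorem NonPeripheral.artinRep {n : ℕ} {w : FreeGroup ℕ} (h : NonPeripheral n w) (β : Braid n) :
    NonPeripheral n (artinRep n β w) := by
  refine ⟨(artinRep_mem_freeSub β w).2 h.1, fun k e => h.2 k ?_⟩
  rw [← artinRep_bd β, ← map_zpow] at e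
  exact (BraidedThompson.artinRep n β).injective e

theorem NonPeripheral.cab {n k : ℕ} {w : FreeGroup ℕ} (h : NonPeripheral n w) (hk : k < n) :
    NonPeripheral (n + 1) (cab k w) := by
  refine ⟨cab_mem_freeSub h.1, fun j e => h.2 j ?_⟩
  have hb : BraidedThompson.cab k (bd n) = bd (n + 1) := by rw [cab_bd, if_neg (by omega)]
  rw [← hb, ← map_zpow] at e
  exact cab_injective k e

/-- The base points `1` and `bd n` are neighbours on the boundary of the universal cover. If `w`
starts with the boundary word, the order is seen at the vertex `bd n`, where `1` lies in direction
`2 * n`, the last one available in `freeSub n`. -/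
theorem Cyc.one_bd {n : ℕ} (hn : 1 ≤ n) {w : FreeGroup ℕ} (h : NonPeripheral n w) :
    Cyc 1 (bd n) w := by
  have h1 : w ≠ 1 := by simpa using h.2 0
  by_cases hw : Pre n w
  · refine ⟨bd n, ?_⟩
    have h2 : first ((bd n)⁻¹ * w) ≤ 2 * n :=
      first_le_of_mem_freeSub (mul_mem (inv_mem (bd_mem_freeSub le_rfl)) h.1)
    have h3 : first ((bd n)⁻¹ * w) ≠ 0 := by
      rw [Ne, first_eq_zero, inv_mul_eq_one]
      simpa using (h.2 1).symm
    rw [mul_one, first_bd_inv, inv_mul_cancel, first_one]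
    rw [Pre] at hw
    unfold cyc
    omega
  · exact Cyc.of_Pre hn (Pre_bd hn) hw h1

theorem Cyc.bd_of_one {n : ℕ} (hn : 1 ≤ n) {y w : FreeGroup ℕ} (hy : NonPeripheral n y)
    (h : Cyc 1 y w) : Cyc (bd n) y w :=
  (h.rot.trans (Cyc.one_bd hn hy).rot.rot).rot.rot

theorem Cyc.bd_iff {n : ℕ} (hn : 1 ≤ n) {y w : FreeGroup ℕ} (hy : NonPeripheral n y)
    (hw : NonPeripheral n w) : Cyc (bd n) y w ↔ Cyc 1 y w := by
  refine ⟨fun h => ?_, Cyc.bd_of_one hn hy⟩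
  rcases Cyc.total (p := 1) (q := y) (r := w) (by simpa using (hy.2 0).symm) h.rot.ne
    (by simpa using hw.2 0) with h' | h'
  · exact h'
  · exact (h.asymm (h'.bd_of_one hn hw)).elim

/-- No non-peripheral element separates consecutive powers of `bd n`, so cutting the cyclic order at
any of them gives the same linear order. This makes the order invariant under translation by `bd n`.
-/
theorem Cyc.zpow_iff {n : ℕ} (hn : 1 ≤ n) {y w : FreeGroup ℕ} (hy : NonPeripheral n y)
    (hw : NonPeripheral n w) (k : ℤ) : Cyc (bd n ^ k) y w ↔ Cyc 1 y w := by
  have step : ∀ k : ℤ, Cyc (bd n ^ (k + 1)) y w ↔ Cyc (bd n ^ k) y w := fun k => by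
    have h := Cyc.bd_iff hn (hy.zpow_mul (-k)) (hw.zpow_mul (-k))
    constructor
    · intro h'
      have := (h.1 (by simpa [zpow_add] using h'.mul_left (bd n ^ (-k)))).mul_left (bd n ^ k)
      simpa [zpow_neg] using this
    · intro h'
      have := (h.2 (by simpa using h'.mul_left (bd n ^ (-k)))).mul_left (bd n ^ k)
      simpa [zpow_neg, zpow_add] using this
  induction k using Int.induction_on with
  | zero => simp
  | succ k ih => exact (step k).trans ih
  | pred k ih =>
    have := step (-k - 1)
    rw [sub_add_cancel] at this
    exact this.symm.trans ih

/-- Translation by `bd n ^ (-twist n w)` leads to `Cyc.of_Pre`: the translate of `y` still starts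
with the boundary word, that of `w` does not. -/
theorem Cyc.of_twist_lt {n : ℕ} (hn : 1 ≤ n) {y w : FreeGroup ℕ} (hy : NonPeripheral n y)
    (hw : NonPeripheral n w) (h : twist n w < twist n y) : Cyc 1 y w := by
  have h1 := (Pre_zpow_iff hn y _).2 h
  have h2 : ¬ Pre n (bd n ^ (-twist n w) * w) := fun h => lt_irrefl _ ((Pre_zpow_iff hn w _).1 h)
  have h3 := (Cyc.of_Pre hn h1 h2
    (by simpa using (hw.zpow_mul (-twist n w)).2 0)).mul_left (bd n ^ twist n w)
  rw [← Cyc.zpow_iff hn hy hw (twist n w)]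
  simpa [zpow_neg] using h3

/-- The exponent `twist n b - twist n a + 1` makes the twisting number of the translate of `a`
exceed that of `b` by one. If the inequality failed, the images under `β` would compare the other
way round, although `β` preserves the order and fixes `bd n`. -/
theorem twist_artinRep_le {n : ℕ} (hn : 1 ≤ n) {a b : FreeGroup ℕ} (ha : NonPeripheral n a)
    (hb : NonPeripheral n b) (β : Braid n) : twist n (artinRep n β b) - twist n (artinRep n β a) ≤
      twist n b - twist n a + 1 := by
  by_contra! hc
  have h1 : Cyc 1 (bd n ^ (twist n b - twist n a + 1) * a) b :=
    Cyc.of_twist_lt hn (ha.zpow_mul _) hb (by rw [twist_zpow_mul hn]; omega)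
  have h2 : Cyc 1 (artinRep n β b) (artinRep n β (bd n ^ (twist n b - twist n a + 1) * a)) :=
    Cyc.of_twist_lt hn (hb.artinRep β) ((ha.zpow_mul _).artinRep β) (by
      rw [map_mul, map_zpow, artinRep_bd, twist_zpow_mul hn]; omega)
  have h3 := (cyc_artinRep β _ _ _).2 h1
  rw [map_one] at h3
  exact h2.asymm h3

theorem abs_twist_artinRep_le {n : ℕ} (hn : 1 ≤ n) {a b : FreeGroup ℕ} (ha : NonPeripheral n a)
    (hb : NonPeripheral n b) (β : Braid n) :
    |twist n (artinRep n β b) - twist n (artinRep n β a) - (twist n b - twist n a)| ≤ 1 := by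
  have h1 := twist_artinRep_le hn ha hb β
  have h2 := twist_artinRep_le hn hb ha β
  rw [abs_le]
  omega

/-! ### The twisting number of a representative triple -/

/-- For `n = 1` the last generator is the boundary word itself; this is the source of the condition
of having at least two leaves in what follows. -/
theorem nonPeripheral_last {n : ℕ} (hn : 2 ≤ n) : NonPeripheral n (FreeGroup.of (n - 1)) := by
  refine ⟨of_mem_freeSub (by omega), fun k e => ?_⟩
  have h1 : twist n (FreeGroup.of (n - 1)) = 0 :=
    twist_eq_zero (by omega) (by rw [first_of]; omega) (by rw [first_of]; omega)
  have h2 := twist_zpow_mul (n := n) (by omega) k 1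
  have h3 : twist n 1 = 0 := twist_eq_zero (by omega) (by simp [first_one])
    (by rw [first_one]; omega)
  rw [mul_one, ← e, h1, h3] at h2
  obtain rfl : k = 0 := by omega
  rw [zpow_zero] at e
  exact FreeGroup.of_ne_one _ e

theorem twist_last {n : ℕ} (hn : 2 ≤ n) : twist n (FreeGroup.of (n - 1)) = 0 :=
  twist_eq_zero (by omega) (by rw [first_of]; omega) (by rw [first_of]; omega)

/-- The twisting number of the last strand of a triple. -/
noncomputable def Triple.twist (t : Triple) : ℤ :=
  BraidedThompson.twist t.n (artinRep t.n t.braid (FreeGroup.of (t.n - 1)))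

open Relation

theorem le_of_expands {a b : Triple} (h : ReflTransGen Expands a b) : a.n ≤ b.n := by
  induction h with
  | refl => exact le_rfl
  | tail _ hs ih => obtain ⟨k, rfl⟩ := hs; exact ih.trans (Nat.le_succ _)

/-- The old last generator is carried through all expansions by `cab`, at no cost. It is compared
with the new last generator only once, at the end, so the bound does not depend on the number of
expansions. -/
theorem twist_expands {a b : Triple} (h : ReflTransGen Expands a b) (ha : 2 ≤ a.n) :
    |b.twist - a.twist| ≤ 1 := by
  have key : ∃ y, NonPeripheral b.n y ∧ twist b.n y = 0 ∧
      twist b.n (artinRep b.n b.braid y) = a.twist := by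
    induction h with
    | refl => exact ⟨_, nonPeripheral_last ha, twist_last ha, rfl⟩
    | tail _ hs ih =>
      obtain ⟨k, rfl⟩ := hs
      obtain ⟨y, h1, h2, h3⟩ := ih
      refine ⟨cab k y, h1.cab k.2, (twist_cab k.2 y).trans h2, ?_⟩
      refine Eq.trans ?_ h3
      refine Eq.trans ?_ (twist_cab (rho (Triple.braid _) k).2 _)
      exact congrArg _ (artinRep_bifurcate _ k y)
  obtain ⟨y, h1, h2, h3⟩ := key
  have hb := ha.trans (le_of_expands h)
  have := abs_twist_artinRep_le (by omega) h1 (nonPeripheral_last hb) b.braid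
  rwa [h2, h3, twist_last hb, sub_zero, sub_zero] at this

theorem twist_toBV {a b : Triple} (h : a.toBV = b.toBV) (ha : 2 ≤ a.n) (hb : 2 ≤ b.n) :
    |a.twist - b.twist| ≤ 2 := by
  obtain ⟨c, h1, h2⟩ := toBV_eq_iff.1 h
  have h3 := twist_expands h1 ha
  have h4 := twist_expands h2 hb
  rw [abs_le] at *
  omega

/-- Compare the action of `β` on the last generator with its action on the image of the last
generator under `γ`. -/
theorem twist_comp {a b c : Triple} (h : Comp a b c) (hn : 2 ≤ b.n) :
    |c.twist - a.twist - b.twist| ≤ 1 := by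
  cases h with
  | mk n l m r hl hm hr β γ =>
    have := abs_twist_artinRep_le (le_of_lt hn) (nonPeripheral_last hn)
      ((nonPeripheral_last hn).artinRep γ) β
    rw [twist_last hn, ← MulAut.mul_apply, ← map_mul] at this
    change |twist n (artinRep n (β * γ) (FreeGroup.of (n - 1))) -
      twist n (artinRep n β (FreeGroup.of (n - 1))) -
      twist n (artinRep n γ (FreeGroup.of (n - 1)))| ≤ 1
    dsimp only at this
    rw [abs_le] at *
    omega

/-! ### Twisting numbers on bV and the statement on factorisations. -/

theorem BV.exists_rep_two_le (x : BV) : ∃ t : Triple, t.toBV = x ∧ 2 ≤ t.n := by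
  obtain ⟨t, rfl⟩ := x.exists_rep
  have hpos : 0 < t.n := t.right_leaves ▸ numLeaves_pos t.right
  exact ⟨t.expand ⟨0, hpos⟩, (toBV_eq (.single ⟨_, rfl⟩)).symm, Nat.succ_le_succ hpos⟩

/-- The twisting number on `bV` (well defined up to a bounded error only). -/
noncomputable def BV.twist (x : BV) : ℤ := x.exists_rep_two_le.choose.twist

theorem BV.twist_toBV (t : Triple) (h : 2 ≤ t.n) : |t.toBV.twist - t.twist| ≤ 2 :=
  BraidedThompson.twist_toBV t.toBV.exists_rep_two_le.choose_spec.1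
    t.toBV.exists_rep_two_le.choose_spec.2 h

/-- The constant is `1 + 1` for expanding the factors, `1` for composing, and `2` for the change of
representative of the product. -/
theorem BV.twist_mul (x y : BV) : |(x * y).twist - x.twist - y.twist| ≤ 5 := by
  obtain ⟨hx, hx2⟩ := x.exists_rep_two_le.choose_spec
  obtain ⟨hy, hy2⟩ := y.exists_rep_two_le.choose_spec
  have ex : x.twist = x.exists_rep_two_le.choose.twist := rfl
  have ey : y.twist = y.exists_rep_two_le.choose.twist := rfl
  generalize x.exists_rep_two_le.choose = a at *
  generalize y.exists_rep_two_le.choose = b at *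
  obtain ⟨a', b', c', h1, h2, h3⟩ := exists_comp a b
  have hb := hy2.trans (le_of_expands h2)
  have hc : 2 ≤ c'.n := by cases h3; exact hb
  have e : x * y = c'.toBV := by rw [← hx, ← hy, toBV_eq h1, toBV_eq h2, h3.toBV_mul]
  have i1 := twist_expands h1 hx2
  have i2 := twist_expands h2 hy2
  have i3 := twist_comp h3 hb
  have i4 := BV.twist_toBV c' hc
  rw [e, ex, ey]
  rw [abs_le] at *
  omega

theorem BV.twist_bVhat {x : BV} (hx : x ∈ bVhat) : |x.twist| ≤ 2 := by
  obtain ⟨t, rfl, ht⟩ := hx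
  have hpos : 0 < t.n := t.right_leaves ▸ numLeaves_pos t.right
  -- One expansion ensures at least two leaves.
  have h1 : ReflTransGen Expands t (t.expand ⟨0, hpos⟩) := .single ⟨_, rfl⟩
  have h2 : 2 ≤ (t.expand ⟨0, hpos⟩).n := Nat.succ_le_succ hpos
  have h3 := BV.twist_toBV _ h2
  have h4 := expands_mem_hatBraid h1 ht
  rwa [← toBV_eq h1, Triple.twist, artinRep_last h4, twist_last h2, sub_zero] at h3

/-- Three products cost `5` each; `h` and `c * c⁻¹ = 1` lie in `bVhat` and cost `2` each. -/
theorem BV.twist_conj {c h x : BV} (hh : h ∈ bVhat) (hx : x = c * h * c⁻¹) : |x.twist| ≤ 19 := by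
  have h1 := BV.twist_mul (c * h) c⁻¹
  have h2 := BV.twist_mul c h
  have h3 := BV.twist_mul c c⁻¹
  have h4 := BV.twist_bVhat hh
  have h5 := BV.twist_bVhat (one_mem bVhat)
  rw [mul_inv_cancel] at h3
  rw [← hx] at h1
  rw [abs_le] at *
  omega

/-- Each factor contributes at most `19`, and each multiplication `5`; the remaining `2` bounds the
twisting number of the identity. -/
theorem BV.twist_prod (L : List BV)
    (hL : ∀ x ∈ L, ∃ h ∈ bVhat, ∃ c : BV, x = c * h * c⁻¹) :
    |L.prod.twist| ≤ 24 * L.length + 2 := by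
  induction L with
  | nil => simpa using BV.twist_bVhat (one_mem bVhat)
  | cons x L ih =>
    have h1 := ih fun y hy => hL y (List.mem_cons_of_mem _ hy)
    obtain ⟨h, hh, c, hx⟩ := hL x List.mem_cons_self
    have h2 := BV.twist_conj hh hx
    have h3 := BV.twist_mul x L.prod
    rw [List.prod_cons, List.length_cons]
    push_cast
    rw [abs_le] at *
    omega

theorem first_bd_two_zpow (m : ℕ) : first ((bd 2)⁻¹ ^ m) ≠ 1 := by
  have e : (bd 2)⁻¹ = (FreeGroup.of 1)⁻¹ * (FreeGroup.of 0)⁻¹ := by simp [bd]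
  induction m with
  | zero => simp [first_one]
  | succ m ih =>
    rw [pow_succ', e, mul_assoc, ← e]
    have h1 := first_inv_mul (i := 0).2 ih
    rw [first_inv_mul.2 (by omega)]
    omega

/-- The square of the generator is the full twist of two strands, acting on `freeSub 2` as
conjugation by the boundary word. Its powers put `bd 2 ^ m` in front of the last generator, and the
inverse power behind it does not cancel this. -/
theorem le_twist_full (m : ℕ) : (m : ℤ) ≤
    Triple.twist ⟨2, .node () .nil .nil, .node () .nil .nil, by simp, by simp,
      (sigma 2 0 ^ 2) ^ m⟩ := by
  have h1 : ∀ w ∈ freeSub 2, artinRep 2 (sigma 2 0 ^ 2) w = bd 2 * w * (bd 2)⁻¹ := by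
    intro w hw
    induction hw using Subgroup.closure_induction with
    | mem x hx =>
      obtain ⟨j, hj, rfl⟩ := hx
      rw [pow_two, map_mul, MulAut.mul_apply, artinRep_sigma (by omega), artinRep_sigma (by omega)]
      rcases (by omega : j = 0 ∨ j = 0 + 1) with rfl | rfl
      · rw [artinHom_self, map_mul, map_mul, map_inv, artinHom_self, artinHom_succ]
        simp only [bd]; group
      · rw [artinHom_succ, artinHom_self]
        simp only [bd]; group
    | one => simp
    | mul x y _ _ hx hy => rw [map_mul, hx, hy]; group
    | inv x _ hx => rw [map_inv, hx]; group
  have h2 : ∀ m : ℕ, artinRep 2 ((sigma 2 0 ^ 2) ^ m) (FreeGroup.of 1) =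
      bd 2 ^ m * (FreeGroup.of 1 * (bd 2)⁻¹ ^ m) := by
    intro m
    induction m with
    | zero => simp
    | succ m ih =>
      have hb := bd_mem_freeSub (m := 2) le_rfl
      rw [pow_succ', map_mul, MulAut.mul_apply, ih, h1, pow_succ', pow_succ]
      · group
      · exact mul_mem (pow_mem hb _) (mul_mem (of_mem_freeSub (by omega)) (pow_mem (inv_mem hb) _))
  have h3 : 0 ≤ twist 2 (FreeGroup.of 1 * (bd 2)⁻¹ ^ m) := by
    have h4 := (Pre_zpow_iff (n := 2) (by omega) (FreeGroup.of 1 * (bd 2)⁻¹ ^ m) (-1)).1 (by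
      rw [neg_neg, zpow_one, Pre_bd_mul]
      cases m with
      | zero => simp [first_of]
      | succ m =>
        have e : FreeGroup.of 1 * (bd 2)⁻¹ ^ (m + 1) = (FreeGroup.of 0)⁻¹ * (bd 2)⁻¹ ^ m := by
          rw [pow_succ', ← mul_assoc]; simp [bd]
        rw [e, first_inv_mul.2 (first_bd_two_zpow m)]
        omega)
    omega
  change (m : ℤ) ≤ twist 2 (artinRep 2 ((sigma 2 0 ^ 2) ^ m) (FreeGroup.of 1))
  rw [h2, ← zpow_natCast, twist_zpow_mul (by omega)]
  omega

theorem not_bounded_conjugate_factorisation :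
    ¬ ∃ N : ℕ, ∀ g : BV, ∃ L : List BV, L.length ≤ N ∧
      (∀ x ∈ L, ∃ h ∈ bVhat, ∃ c : BV, x = c * h * c⁻¹) ∧ L.prod = g := by
  rintro ⟨N, hN⟩
  -- Passing to the class loses at most `2`, so the exponent `24 * N + 5` leaves more than the bound
  -- `24 * N + 2` from `BV.twist_prod`.
  obtain ⟨L, h1, h2, h3⟩ := hN (Triple.toBV ⟨2, .node () .nil .nil, .node () .nil .nil, by simp,
    by simp, (sigma 2 0 ^ 2) ^ (24 * N + 5)⟩)
  have h4 := BV.twist_prod L h2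
  rw [h3] at h4
  have h5 := le_twist_full (24 * N + 5)
  have h6 := BV.twist_toBV ⟨2, .node () .nil .nil, .node () .nil .nil, by simp,
    by simp, (sigma 2 0 ^ 2) ^ (24 * N + 5)⟩ le_rfl
  rw [abs_le] at *
  push_cast at h5
  omega

end BraidedThompson

/-! ### Homogenisation of quasimorphisms and the doubling of their defect. -/

namespace BraidedThompson

/-! ### Homogeneous quasimorphisms -/

/-- A homogeneous quasimorphism. -/
structure IsHomogeneous {G : Type*} [Group G] (φ : G → ℝ) : Prop where
  quasi : IsQuasimorphism φ
  pow : ∀ (g : G) (n : ℕ), φ (g ^ n) = n * φ g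

theorem eq_zero_of_nat_mul_le {x C : ℝ} (h : ∀ n : ℕ, n * |x| ≤ C) : x = 0 := by
  by_contra hx
  have hpos : 0 < |x| := abs_pos.2 hx
  obtain ⟨n, hn⟩ := exists_nat_gt (C / |x|)
  rw [div_lt_iff₀ hpos] at hn
  exact absurd (h n) (not_le.2 hn)

theorem quasi_pow {G : Type*} [Group G] {q : G → ℝ} {D : ℝ}
    (hD : ∀ g h : G, |q g + q h - q (g * h)| ≤ D) (g : G) (n : ℕ) :
    |q (g ^ (n + 1)) - (n + 1) * q g| ≤ n * D := by
  induction n with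
  | zero => simp
  | succ n ih =>
    have h1 := hD (g ^ (n + 1)) g
    rw [← pow_succ] at h1
    push_cast
    rw [abs_le] at *
    constructor <;> nlinarith

-- Here `φ g` is the limit of `q (g ^ n) / n`. It exists by Fekete's lemma, because `q (g ^ n) + D`
-- is subadditive in `n`.
open Filter Topology in
theorem exists_homogenization {G : Type*} [Group G] {q : G → ℝ} (hq : IsQuasimorphism q) :
    ∃ φ : G → ℝ, IsHomogeneous φ ∧ ∃ C : ℝ, ∀ g, |q g - φ g| ≤ C := by
  obtain ⟨D, hD⟩ := hq
  have hD0 : 0 ≤ D := (abs_nonneg _).trans (hD 1 1)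
  have hlim : ∀ g, ∃ l, Tendsto (fun n : ℕ => q (g ^ n) / n) atTop (𝓝 l) := by
    intro g
    have hsub : Subadditive fun n : ℕ => q (g ^ n) + D := fun m n => by
      have := hD (g ^ m) (g ^ n)
      rw [← pow_add, abs_le] at this
      dsimp only
      linarith
    have hbdd : BddBelow (Set.range fun n : ℕ => (q (g ^ n) + D) / n) := by
      refine ⟨min 0 (q g - D), ?_⟩
      rintro _ ⟨n, rfl⟩
      rcases n with _ | n
      · simp
      · refine (min_le_right _ _).trans ?_
        have h1 := quasi_pow hD g n
        have h2 : (0 : ℝ) < (n + 1 : ℕ) := by positivity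
        rw [le_div_iff₀ h2]
        rw [abs_le] at h1
        push_cast
        nlinarith
    refine ⟨_, (hsub.tendsto_lim hbdd).sub (tendsto_const_div_atTop_nhds_zero_nat D) |>.congr
      fun n => ?_⟩
    ring
  choose φ hφ using hlim
  have hbound : ∀ g, |q g - φ g| ≤ D := fun g => by
    have h1 : Tendsto (fun n : ℕ => |q g - q (g ^ (n + 1)) / ((n + 1 : ℕ) : ℝ)|) atTop
        (𝓝 |q g - φ g|) :=
      (tendsto_const_nhds.sub ((tendsto_add_atTop_iff_nat 1).2 (hφ g))).abs
    refine le_of_tendsto' h1 fun n => ?_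
    have h2 : (0 : ℝ) < (n + 1 : ℕ) := by positivity
    have h3 := quasi_pow hD g n
    have h4 : q g - q (g ^ (n + 1)) / ((n + 1 : ℕ) : ℝ) =
        -(q (g ^ (n + 1)) - (n + 1) * q g) / ((n + 1 : ℕ) : ℝ) := by
      field_simp
      push_cast
      ring
    rw [h4, abs_div, abs_neg, abs_of_pos h2, div_le_iff₀ h2]
    push_cast
    nlinarith
  refine ⟨φ, ⟨⟨4 * D, fun g h => ?_⟩, fun g m => ?_⟩, D, hbound⟩
  · have h1 := hbound g
    have h2 := hbound h
    have h3 := hbound (g * h)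
    have h4 := hD g h
    rw [abs_le] at *
    constructor <;> linarith
  · rcases m with _ | m
    · have h1 := hφ 1
      simp only [one_pow] at h1
      have := tendsto_nhds_unique h1 (tendsto_const_div_atTop_nhds_zero_nat (q 1))
      simp [this]
    · have h1 : Tendsto (fun n : ℕ => (m + 1) * n) atTop atTop :=
        tendsto_id.const_mul_atTop' (Nat.succ_pos m)
      refine tendsto_nhds_unique (hφ (g ^ (m + 1))) ?_
      refine (((hφ g).comp h1).const_mul ((m + 1 : ℕ) : ℝ)).congr fun n => ?_
      simp only [Function.comp_apply, pow_mul]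
      push_cast
      rcases eq_or_ne (n : ℝ) 0 with h | h
      · simp [h]
      · field_simp

namespace IsHomogeneous

variable {G : Type*} [Group G] {φ : G → ℝ}

theorem comp (h : IsHomogeneous φ) {H : Type*} [Group H] (f : H →* G) :
    IsHomogeneous fun x => φ (f x) := by
  obtain ⟨D, hD⟩ := h.quasi
  exact ⟨⟨D, fun x y => by simpa using hD (f x) (f y)⟩, fun x n => by simp only [map_pow, h.pow]⟩

/-- Passing to `n`-th powers multiplies the failure of additivity by `n`, while it stays below the
defect. -/
theorem mul_of_commute (h : IsHomogeneous φ) {x y : G} (hxy : Commute x y) :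
    φ (x * y) = φ x + φ y := by
  obtain ⟨D, hD⟩ := h.quasi
  refine (sub_eq_zero.1 (eq_zero_of_nat_mul_le (C := D) fun n => ?_)).symm
  have h1 := hD (x ^ n) (y ^ n)
  rw [← hxy.mul_pow, h.pow, h.pow, h.pow] at h1
  rwa [← Nat.abs_cast n, ← abs_mul, mul_sub, mul_add]

theorem conj (h : IsHomogeneous φ) (c x : G) : φ (c * x * c⁻¹) = φ x := by
  obtain ⟨D, hD⟩ := h.quasi
  refine sub_eq_zero.1 (eq_zero_of_nat_mul_le (C := 2 * D + |φ c| + |φ c⁻¹|) fun n => ?_)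
  have h1 := hD (c * x ^ n) c⁻¹
  have h2 := hD c (x ^ n)
  rw [← conj_pow, h.pow] at h1
  rw [h.pow] at h2
  rw [← Nat.abs_cast n, ← abs_mul, mul_sub]
  have h3 := abs_le.1 (le_refl |φ c|)
  have h4 := abs_le.1 (le_refl |φ c⁻¹|)
  rw [abs_le] at h1 h2
  rw [abs_le]
  constructor <;> linarith

/-- If `ι` is an endomorphism such that the image of `ι` commutes with a conjugate of itself and
`ι ∘ ι` is conjugate to `ι`, then homogeneous quasimorphisms become homomorphisms when restricted
along `ι`. -/
theorem map_mul_of_commuting_conjugate (h : IsHomogeneous φ) (ι : G →* G) (c d : G)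
    (hc : ∀ x y, Commute (ι x) (c * ι y * c⁻¹)) (hd : ∀ x, ι (ι x) = d * ι x * d⁻¹) (x y : G) :
    φ (ι (x * y)) = φ (ι x) + φ (ι y) := by
  have hΦ := h.comp ι
  obtain ⟨D, hD⟩ := hΦ.quasi
  have hι : ∀ x, φ (ι (ι x)) = φ (ι x) := fun x => by rw [hd, h.conj]
  have hdiag : ∀ x, φ (ι (ι x * (c * ι x * c⁻¹))) = 2 * φ (ι x) := fun x => by
    rw [hΦ.mul_of_commute (hc x x), hΦ.conj c (ι x), hι]; ring
  -- The map sending `x` to `ι x * (c * ι x * c⁻¹)` is multiplicative, as its factors commute, and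
  -- by `hdiag` it doubles `φ ∘ ι`. Iterating it multiplies the failure of additivity by `2 ^ n`,
  -- under the same bound `D`.
  have hpow : ∀ (n : ℕ) (x y : G), 2 ^ n * |φ (ι x) + φ (ι y) - φ (ι (x * y))| ≤ D := by
    intro n
    induction n with
    | zero => intro x y; simpa using hD x y
    | succ n ih =>
      intro x y
      have h1 := ih (ι x * (c * ι x * c⁻¹)) (ι y * (c * ι y * c⁻¹))
      have h2 : ι x * (c * ι x * c⁻¹) * (ι y * (c * ι y * c⁻¹)) =
          ι (x * y) * (c * ι (x * y) * c⁻¹) := by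
        have := (hc y x).eq
        calc _ = ι x * ((c * ι x * c⁻¹) * ι y) * (c * ι y * c⁻¹) := by group
          _ = ι x * (ι y * (c * ι x * c⁻¹)) * (c * ι y * c⁻¹) := by rw [this]
          _ = _ := by rw [map_mul]; group
      rw [h2, hdiag, hdiag, hdiag, ← mul_add, ← mul_sub, abs_mul, abs_two] at h1
      rw [pow_succ, mul_assoc]
      exact h1
  have h0 : φ (ι x) + φ (ι y) - φ (ι (x * y)) = 0 := by
    refine eq_zero_of_nat_mul_le (C := D) fun n => le_trans ?_ (hpow n x y)
    gcongr
    exact_mod_cast Nat.lt_two_pow_self.le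
  linarith

end IsHomogeneous

end BraidedThompson

/-! ### Elements of bV acting on one half, and how they are conjugate to each other. -/

namespace BraidedThompson

/-! ### Shifted inclusions of braid groups -/

/-- The inclusion of `B_n` into `B_m` as the braids on the strands `a, …, a + n - 1`. -/
def shiftHom (a n m : ℕ) (h : a + n ≤ m) : Braid n →* Braid m :=
  PresentedGroup.toGroup (f := fun i : Fin (n - 1) => sigma m (a + i)) (by
    rintro r (⟨i, j, hij, rfl⟩ | ⟨i, j, hij, rfl⟩)
    · have := j.2
      simp only [map_mul, map_inv, FreeGroup.lift_apply_of, mul_inv_eq_one]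
      exact sigma_comm (by omega) (by omega)
    · have := j.2
      simp only [map_mul, map_inv, FreeGroup.lift_apply_of, mul_inv_eq_one]
      rw [← hij, ← add_assoc]
      exact sigma_braid (by omega))

theorem shiftHom_of {a n m : ℕ} (h : a + n ≤ m) (i : Fin (n - 1)) :
    shiftHom a n m h (PresentedGroup.of i) = sigma m (a + i) := by
  simp [shiftHom]

theorem shiftHom_sigma {a n m : ℕ} (h : a + n ≤ m) {i : ℕ} (hi : i + 1 < n) :
    shiftHom a n m h (sigma n i) = sigma m (a + i) := by
  rw [sigma, dif_pos (by omega), shiftHom_of]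

theorem shiftHom_shiftHom {n m l : ℕ} (h : 0 + n ≤ m) (h' : 0 + m ≤ l) (β : Braid n) :
    shiftHom 0 m l h' (shiftHom 0 n m h β) = shiftHom 0 n l (by omega) β := by
  induction β using braid_induction with
  | h1 => simp
  | hof i =>
    have := i.2
    rw [shiftHom_of, shiftHom_of, shiftHom_sigma _ (by omega), zero_add]
  | hmul β γ hβ hγ => simp only [map_mul, hβ, hγ]
  | hinv β hβ => simp only [map_inv, hβ]

theorem shiftHom_commute {n m N : ℕ} (h : 0 + n ≤ N) (h' : n + m ≤ N) (β : Braid n)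
    (γ : Braid m) : Commute (shiftHom 0 n N h β) (shiftHom n m N h' γ) := by
  induction β using braid_induction with
  | h1 => rw [map_one]; exact Commute.one_left _
  | hof i =>
    induction γ using braid_induction with
    | h1 => rw [map_one]; exact Commute.one_right _
    | hof j =>
      have := i.2
      have := j.2
      rw [shiftHom_of, shiftHom_of]
      exact sigma_comm (by omega) (by omega)
    | hmul β γ hβ hγ => rw [map_mul]; exact hβ.mul_right hγ
    | hinv β hβ => rw [map_inv]; exact hβ.inv_right
  | hmul β γ hβ hγ => rw [map_mul]; exact hβ.mul_left hγ
  | hinv β hβ => rw [map_inv]; exact hβ.inv_left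

theorem rho_shiftHom_mid {a n m : ℕ} (h : a + n ≤ m) (β : Braid n) : ∀ k : Fin n,
    rho (shiftHom a n m h β) ⟨a + k, by omega⟩ = ⟨a + rho β k, by omega⟩ := by
  induction β using braid_induction with
  | h1 => simp
  | hof i =>
    intro k
    have := i.2
    ext
    rw [shiftHom_of, rho_sigma_val (by omega)]
    simp only [rho_of, genPerm_val, natSwap]
    split_ifs <;> omega
  | hmul β γ hβ hγ => intro k; simp only [map_mul, Equiv.Perm.mul_apply, hβ, hγ]
  | hinv β hβ =>
    intro k
    obtain ⟨k, rfl⟩ := (rho β).surjective k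
    rw [map_inv, map_inv, Equiv.Perm.inv_eq_iff_eq, hβ]
    simp

theorem rho_shiftHom_out {a n m : ℕ} (h : a + n ≤ m) (β : Braid n) : ∀ k : Fin m,
    ((k : ℕ) < a ∨ a + n ≤ k) → rho (shiftHom a n m h β) k = k := by
  induction β using braid_induction with
  | h1 => simp
  | hof i =>
    intro k hk
    have := i.2
    ext
    rw [shiftHom_of, rho_sigma_val (by omega), natSwap, if_neg (by omega), if_neg (by omega)]
  | hmul β γ hβ hγ =>
    intro k hk; rw [map_mul, map_mul, Equiv.Perm.mul_apply, hγ k hk, hβ k hk]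
  | hinv β hβ =>
    intro k hk
    rw [map_inv, map_inv, Equiv.Perm.inv_eq_iff_eq, hβ k hk]

theorem bifurcate_shiftHom_mid {a n m : ℕ} (h : a + n ≤ m) (β : Braid n) : ∀ k : Fin n,
    bifurcate ⟨a + k, by omega⟩ (shiftHom a n m h β) =
      shiftHom a (n + 1) (m + 1) (by omega) (bifurcate k β) := by
  induction β using braid_induction with
  | h1 => simp [bifurcate_one]
  | hof i =>
    intro k
    have := i.2
    rw [shiftHom_of, bifurcate_sigma (by omega), bifurcate_of]
    dsimp only
    rcases (by omega : (k : ℕ) < i ∨ (k : ℕ) = i ∨ (k : ℕ) = i + 1 ∨ (i : ℕ) + 1 < k) with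
      h' | h' | h' | h'
    · rw [genBif_lt _ h', genBif_lt _ (by omega), shiftHom_sigma _ (by omega), add_assoc]
    · rw [h', genBif_self, genBif_self, map_mul, shiftHom_sigma _ (by omega),
        shiftHom_sigma _ (by omega), add_assoc]
    · rw [h', ← add_assoc, genBif_succ, genBif_succ, map_mul, shiftHom_sigma _ (by omega),
        shiftHom_sigma _ (by omega), add_assoc]
    · rw [genBif_gt _ h', genBif_gt _ (by omega), shiftHom_sigma _ (by omega)]
  | hmul β γ hβ hγ =>
    intro k; rw [map_mul, bifurcate_mul, bifurcate_mul, rho_shiftHom_mid, hβ, hγ, map_mul]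
  | hinv β hβ =>
    intro k
    obtain ⟨k, rfl⟩ := (rho β).surjective k
    rw [map_inv, bifurcate_inv, map_inv, ← hβ, ← rho_shiftHom_mid h, bifurcate_inv]

theorem bifurcate_shiftHom_left {a n m : ℕ} (h : a + n ≤ m) (β : Braid n) (k : Fin m)
    (hk : (k : ℕ) < a) : bifurcate k (shiftHom a n m h β) =
      shiftHom (a + 1) n (m + 1) (by omega) β := by
  induction β using braid_induction with
  | h1 => simp [bifurcate_one]
  | hof i =>
    have := i.2
    rw [shiftHom_of, bifurcate_sigma (by omega), genBif_lt _ (by omega), shiftHom_of, add_right_comm]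
  | hmul β γ hβ hγ =>
    rw [map_mul, bifurcate_mul, rho_shiftHom_out h γ k (Or.inl hk), hβ, hγ, map_mul]
  | hinv β hβ =>
    rw [map_inv, map_inv, ← hβ, ← bifurcate_inv, rho_shiftHom_out h β k (Or.inl hk)]

theorem bifurcate_shiftHom_right {a n m : ℕ} (h : a + n ≤ m) (β : Braid n) (k : Fin m)
    (hk : a + n ≤ k) : bifurcate k (shiftHom a n m h β) =
      shiftHom a n (m + 1) (by omega) β := by
  induction β using braid_induction with
  | h1 => simp [bifurcate_one]
  | hof i =>
    have := i.2
    rw [shiftHom_of, bifurcate_sigma (by omega), genBif_gt _ (by omega), shiftHom_of]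
  | hmul β γ hβ hγ =>
    rw [map_mul, bifurcate_mul, rho_shiftHom_out h γ k (Or.inr hk), hβ, hγ, map_mul]
  | hinv β hβ =>
    rw [map_inv, map_inv, ← hβ, ← bifurcate_inv, rho_shiftHom_out h β k (Or.inr hk)]

/-- The braid in which the strand in position `n` passes over to the far left. -/
def cross (N : ℕ) : ℕ → Braid N
  | 0 => 1
  | n + 1 => cross N n * sigma N n

theorem rho_cross {N n : ℕ} (hn : n < N) (k : Fin N) : (rho (cross N n) k : ℕ) =
    if (k : ℕ) < n then (k : ℕ) + 1 else if (k : ℕ) = n then 0 else k := by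
  induction n generalizing k with
  | zero => simp only [cross, map_one, Equiv.Perm.one_apply]; split_ifs <;> omega
  | succ n ih =>
    rw [cross, map_mul, Equiv.Perm.mul_apply, ih (by omega), rho_sigma_val hn, natSwap]
    split_ifs <;> omega

theorem bifurcate_cross_gt {N n : ℕ} (k : Fin N) (hk : n < k) :
    bifurcate k (cross N n) = cross (N + 1) n := by
  induction n with
  | zero => exact bifurcate_one k
  | succ n ih =>
    have e : rho (sigma N n) k = k := Fin.ext (by
      rw [rho_sigma_val (by omega), natSwap_gt (by omega)])
    rw [cross, bifurcate_mul, e, ih (by omega), bifurcate_sigma (by omega),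
      genBif_gt _ (by omega), cross]

theorem bifurcate_cross_lt {N n : ℕ} (hn : n < N) (k : Fin N) (hk : (k : ℕ) < n) :
    bifurcate k (cross N n) = cross (N + 1) (n + 1) := by
  induction n with
  | zero => omega
  | succ n ih =>
    rw [cross, bifurcate_mul, bifurcate_sigma hn]
    rcases (by omega : (k : ℕ) < n ∨ (k : ℕ) = n) with h | h
    · have e : rho (sigma N n) k = k := Fin.ext (by rw [rho_sigma_val hn, natSwap_lt h])
      rw [e, ih (by omega) h, genBif_lt _ h]; rfl
    · have e : ((rho (sigma N n) k : Fin N) : ℕ) = n + 1 := by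
        rw [rho_sigma_val hn, h, natSwap_self]
      rw [bifurcate_cross_gt _ (by omega), h, genBif_self, ← mul_assoc]; rfl

theorem cross_commute {N n j : ℕ} (hj : n < j) (hN : j + 1 < N) :
    Commute (cross N n) (sigma N j) := by
  induction n with
  | zero => exact Commute.one_left _
  | succ n ih => exact (ih (by omega)).mul_left (sigma_comm (by omega) hN)

theorem cross_mul_sigma {N n i : ℕ} (hn : n < N) (hi : i + 1 < n) :
    cross N n * sigma N i = sigma N (i + 1) * cross N n := by
  induction n with
  | zero => omega
  | succ n ih =>
    rw [cross]
    rcases (by omega : i + 1 < n ∨ i + 1 = n) with h | rfl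
    · rw [mul_assoc, ← sigma_comm h (by omega), ← mul_assoc, ih (by omega) h, mul_assoc]
    · rw [cross, mul_assoc (cross N i), mul_assoc (cross N i), sigma_braid (by omega),
        ← mul_assoc, ← mul_assoc, (cross_commute (Nat.lt_succ_self i) (by omega)).eq]
      simp only [mul_assoc]

/-- A strand lying across all the others can be slid past any braid of those; this turns an action
on the left half into one on the right half. -/
theorem cross_mul_shiftHom {n : ℕ} (β : Braid n) :
    cross (n + 1) n * shiftHom 0 n (n + 1) (by omega) β =
      shiftHom 1 n (n + 1) (by omega) β * cross (n + 1) n := by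
  induction β using braid_induction with
  | h1 => simp
  | hof i =>
    have := i.2
    rw [shiftHom_of, shiftHom_of, zero_add, cross_mul_sigma (by omega) (by omega), add_comm (i : ℕ) 1]
  | hmul β γ hβ hγ => rw [map_mul, map_mul, ← mul_assoc, hβ, mul_assoc, hγ, mul_assoc]
  | hinv β hβ =>
    rw [map_inv, map_inv, eq_inv_mul_iff_mul_eq, ← mul_assoc, ← hβ, mul_inv_cancel_right]

/-! ### Calculating with classes of triples -/

/-- The class of the triple with the given components. -/
def cls (n : ℕ) (L R : PTree) (hL : L.numLeaves = n) (hR : R.numLeaves = n) (β : Braid n) : BV :=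
  Triple.toBV ⟨n, L, R, hL, hR, β⟩

theorem BV.exists_cls (x : BV) : ∃ n L R hL hR β, cls n L R hL hR β = x := by
  obtain ⟨⟨n, L, R, hL, hR, β⟩, h⟩ := x.exists_rep
  exact ⟨n, L, R, hL, hR, β, h⟩

theorem cls_mul {n : ℕ} {L M R : PTree} (hL : L.numLeaves = n) (hM : M.numLeaves = n)
    (hR : R.numLeaves = n) (β γ : Braid n) :
    cls n L M hL hM β * cls n M R hM hR γ = cls n L R hL hR (β * γ) :=
  (Comp.mk n L M R hL hM hR β γ).toBV_mul

theorem cls_one {n : ℕ} {T : PTree} (h h' : T.numLeaves = n) : cls n T T h h' 1 = 1 :=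
  toBV_one T h h'

theorem cls_expand {n : ℕ} {L R : PTree} (hL : L.numLeaves = n) (hR : R.numLeaves = n)
    (β : Braid n) (k : Fin n) {L' R' : PTree} (eL : L' = addCaret L (rho β k))
    (eR : R' = addCaret R k) {β' : Braid (n + 1)} (eβ : β' = bifurcate k β) :
    cls (n + 1) L' R' (by rw [eL, numLeaves_addCaret, hL]) (by rw [eR, numLeaves_addCaret, hR]) β' =
      cls n L R hL hR β := by
  subst eL eR eβ
  exact (toBV_eq (.single (a := ⟨n, L, R, hL, hR, β⟩) ⟨k, rfl⟩)).symm

/-- Every tree is obtained from the trivial tree by adding carets. -/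
theorem tree_induction {P : PTree → Prop} (hnil : P .nil)
    (hadd : ∀ T k, k < T.numLeaves → P T → P (addCaret T k)) (T : PTree) : P T := by
  suffices ∀ d U, P U → Sub U T → T.numLeaves ≤ U.numLeaves + d → P T from
    this _ _ hnil trivial (Nat.le_add_left _ _)
  intro d
  induction d with
  | zero =>
    intro U hU hs hd
    rcases hs.eq_or_exists with rfl | ⟨k, hk, h⟩
    · exact hU
    · have := h.numLeaves_le
      rw [numLeaves_addCaret] at this
      omega
  | succ d ih =>
    intro U hU hs hd
    rcases hs.eq_or_exists with rfl | ⟨k, hk, h⟩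
    · exact hU
    · exact ih _ (hadd U k hk hU) h (by rw [numLeaves_addCaret]; omega)

theorem addCaret_node_left {l r : PTree} {k : ℕ} (h : k < l.numLeaves) :
    addCaret (.node () l r) k = .node () (addCaret l k) r := by
  rw [addCaret, if_pos h]

theorem addCaret_node_right {l r : PTree} {j k : ℕ} (h : k = l.numLeaves + j) :
    addCaret (.node () l r) k = .node () l (addCaret r j) := by
  rw [addCaret, if_neg (by omega), h, Nat.add_sub_cancel_left]

theorem numLeaves_node (l r : PTree) :
    (BinaryTree.node () l r).numLeaves = l.numLeaves + r.numLeaves := rfl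

theorem numLeaves_node_nil {L : PTree} {n : ℕ} (h : L.numLeaves = n) :
    (BinaryTree.node () L .nil).numLeaves = n + 1 := by
  simp [h]

theorem numLeaves_nil_node {L : PTree} {n : ℕ} (h : L.numLeaves = n) :
    (BinaryTree.node () .nil L).numLeaves = n + 1 := by
  simp [h, add_comm]

theorem numLeaves_assoc_left {A B C : PTree} {n : ℕ}
    (h : A.numLeaves + B.numLeaves + C.numLeaves = n) :
    (BinaryTree.node () (.node () A B) C).numLeaves = n := h

theorem numLeaves_assoc_right {A B C : PTree} {n : ℕ}
    (h : A.numLeaves + B.numLeaves + C.numLeaves = n) :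
    (BinaryTree.node () A (.node () B C)).numLeaves = n := by
  rw [← h, add_assoc]; rfl

/-- The last strand is not braided, so hanging a tree `S` on the last leaf of both trees is a
sequence of expansions. -/
theorem cls_left_block {n : ℕ} {L R : PTree} (hL : L.numLeaves = n) (hR : R.numLeaves = n)
    (β : Braid n) (S : PTree) : ∀ (N : ℕ) (hN : n + S.numLeaves = N),
    cls N (.node () L S) (.node () R S) (by rw [numLeaves_node]; omega)
      (by rw [numLeaves_node]; omega) (shiftHom 0 n N (by omega) β) =
    cls (n + 1) (.node () L .nil) (.node () R .nil) (numLeaves_node_nil hL) (numLeaves_node_nil hR)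
      (shiftHom 0 n (n + 1) (by omega) β) := by
  induction S using tree_induction with
  | hnil => rintro N rfl; rfl
  | hadd S k hk ih =>
    rintro N rfl
    rw [← ih _ rfl]
    have e := numLeaves_addCaret S k
    have e' : n + (addCaret S k).numLeaves = n + S.numLeaves + 1 := by omega
    generalize_proofs _ h1 h2 h3
    generalize n + (addCaret S k).numLeaves = N at *
    subst e'
    have hout := rho_shiftHom_out (a := 0) (n := n) (m := n + S.numLeaves) (by omega) β
      ⟨n + k, by omega⟩ (Or.inr (by simp))
    refine cls_expand _ _ _ ⟨n + k, by omega⟩ ?_ ?_ ?_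
    · rw [hout, addCaret_node_right (by rw [hL])]
    · rw [addCaret_node_right (by rw [hR])]
    · exact (bifurcate_shiftHom_right _ _ _ (by simp)).symm

theorem cls_right_block {n : ℕ} {L R : PTree} (hL : L.numLeaves = n) (hR : R.numLeaves = n)
    (β : Braid n) (S : PTree) : ∀ (N s : ℕ) (hs : S.numLeaves = s) (hN : s + n = N),
    cls N (.node () S L) (.node () S R) (by rw [numLeaves_node]; omega)
      (by rw [numLeaves_node]; omega) (shiftHom s n N (by omega) β) =
    cls (n + 1) (.node () .nil L) (.node () .nil R) (numLeaves_nil_node hL)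
      (numLeaves_nil_node hR) (shiftHom 1 n (n + 1) (by omega) β) := by
  induction S using tree_induction with
  | hnil =>
    intro N s hs hN
    obtain rfl : 1 = s := hs
    obtain rfl : N = n + 1 := by omega
    rfl
  | hadd S k hk ih =>
    intro N s hs hN
    rw [numLeaves_addCaret] at hs
    subst hs
    obtain rfl : N = S.numLeaves + n + 1 := by omega
    rw [← ih _ _ rfl rfl]
    have hout := rho_shiftHom_out (a := S.numLeaves) (n := n) (m := S.numLeaves + n) le_rfl β
      ⟨k, by omega⟩ (Or.inl hk)
    refine cls_expand _ _ _ ⟨k, by omega⟩ ?_ ?_ ?_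
    · rw [hout, addCaret_node_left hk]
    · rw [addCaret_node_left hk]
    · exact (bifurcate_shiftHom_left _ _ _ hk).symm

/-- Hang on the idle leaf of each element the tree that makes the product composable; the two braids
then involve disjoint sets of strands. -/
theorem left_block_commute_right_block {n m : ℕ} {L R L' R' : PTree} (hL : L.numLeaves = n)
    (hR : R.numLeaves = n) (hL' : L'.numLeaves = m) (hR' : R'.numLeaves = m) (β : Braid n)
    (γ : Braid m) : Commute
      (cls (n + 1) (.node () L .nil) (.node () R .nil) (numLeaves_node_nil hL) (numLeaves_node_nil hR)
        (shiftHom 0 n (n + 1) (by omega) β))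
      (cls (m + 1) (.node () .nil L') (.node () .nil R')
        (numLeaves_nil_node hL')
        (numLeaves_nil_node hR') (shiftHom 1 m (m + 1) (by omega) γ)) := by
  rw [Commute, SemiconjBy]
  nth_rw 1 [← cls_left_block hL hR β L' (n + m) (by omega)]
  rw [← cls_left_block hL hR β R' (n + m) (by omega)]
  nth_rw 1 [← cls_right_block hL' hR' γ R (n + m) n hR rfl]
  rw [← cls_right_block hL' hR' γ L (n + m) n hL rfl, cls_mul, cls_mul,
    (shiftHom_commute _ _ β γ).eq]

/-! ### The copy of `bV` supported on the left half -/

/-- The triple obtained by letting `t` act on the left half. -/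
def Triple.inLeft (t : Triple) : Triple :=
  ⟨t.n + 1, .node () t.left .nil, .node () t.right .nil, numLeaves_node_nil t.left_leaves,
    numLeaves_node_nil t.right_leaves, shiftHom 0 t.n (t.n + 1) (by omega) t.braid⟩

theorem inLeft_toBV_congr {a b : Triple} (h : Relation.ReflTransGen Expands a b) :
    a.inLeft.toBV = b.inLeft.toBV := by
  induction h with
  | refl => rfl
  | @tail b c _ hs ih =>
    obtain ⟨k, rfl⟩ := hs
    rw [ih]
    obtain ⟨n, L, R, hL, hR, β⟩ := b
    change Fin n at k
    have h1 := rho_shiftHom_mid (a := 0) (n := n) (m := n + 1) (by omega) β k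
    have h2 := bifurcate_shiftHom_mid (a := 0) (n := n) (m := n + 1) (by omega) β k
    simp only [zero_add] at h1 h2
    refine (cls_expand (n := n + 1) _ _ _ ⟨k, by omega⟩ ?_ ?_ ?_).symm
    · rw [h1]
      exact (addCaret_node_left (by rw [hL]; exact (rho β k).2)).symm
    · exact (addCaret_node_left (by rw [hR]; exact k.2)).symm
    · exact h2.symm

/-- The homomorphism which lets `bV` act on the left half. -/
noncomputable def inLeft : BV →* BV :=
  MonoidHom.mk' (fun x => Quotient.liftOn x (fun t => t.inLeft.toBV) (fun a b h => by
    obtain ⟨c, h1, h2⟩ := toBV_eq_iff.1 (Quotient.sound h)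
    exact (inLeft_toBV_congr h1).trans (inLeft_toBV_congr h2).symm)) (fun x y => by
    obtain ⟨z, a, b, c, h, rfl, rfl, rfl⟩ := exists_mul x y
    rw [h.toBV_mul]
    cases h with
    | mk n l m r hl hm hr β γ =>
      refine Eq.trans ?_ (cls_mul (n := n + 1) _ _ _ (shiftHom 0 n (n + 1) _ β)
        (shiftHom 0 n (n + 1) _ γ)).symm
      rw [← map_mul]
      rfl)

theorem inLeft_cls {n : ℕ} {L R : PTree} (hL : L.numLeaves = n) (hR : R.numLeaves = n)
    (β : Braid n) : inLeft (cls n L R hL hR β) =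
      cls (n + 1) (.node () L .nil) (.node () R .nil) (numLeaves_node_nil hL) (numLeaves_node_nil hR)
        (shiftHom 0 n (n + 1) (by omega) β) := rfl

/-- The tree with one caret. -/
abbrev caret : PTree := .node () .nil .nil

/-- The element of `bV` crossing the left half and the right half. -/
def swapHalves : BV := cls 2 caret caret (by simp) (by simp) (sigma 2 0)

/-- Repeated bifurcation of the left strand of the single crossing `sigma 2 0` produces `cross`. -/
theorem swapHalves_eq (T : PTree) : ∀ (n : ℕ) (h : T.numLeaves = n),
    cls (n + 1) (.node () .nil T) (.node () T .nil)
      (numLeaves_nil_node h) (numLeaves_node_nil h) (cross (n + 1) n) =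
    swapHalves := by
  induction T using tree_induction with
  | hnil =>
    intro n h
    obtain rfl : 1 = n := h
    rw [swapHalves, cross, cross, one_mul]
  | hadd T k hk ih =>
    intro n h
    rw [numLeaves_addCaret] at h
    subst h
    rw [← ih _ rfl]
    refine cls_expand _ _ _ ⟨k, by omega⟩ ?_ ?_ ?_
    · rw [rho_cross (by omega), if_pos hk]
      exact (addCaret_node_right (add_comm _ _)).symm
    · exact (addCaret_node_left hk).symm
    · exact (bifurcate_cross_lt (by omega) _ hk).symm

theorem swapHalves_conj {n : ℕ} {L R : PTree} (hL : L.numLeaves = n) (hR : R.numLeaves = n)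
    (β : Braid n) : swapHalves * inLeft (cls n L R hL hR β) * swapHalves⁻¹ =
      cls (n + 1) (.node () .nil L) (.node () .nil R)
        (numLeaves_nil_node hL)
        (numLeaves_nil_node hR) (shiftHom 1 n (n + 1) (by omega) β) := by
  rw [mul_inv_eq_iff_eq_mul, inLeft_cls]
  nth_rw 1 [← swapHalves_eq L n hL]
  rw [← swapHalves_eq R n hR, cls_mul, cls_mul, cross_mul_shiftHom]

theorem inLeft_commute (x y : BV) : Commute (inLeft x) (swapHalves * inLeft y * swapHalves⁻¹) := by
  obtain ⟨n, L, R, hL, hR, β, rfl⟩ := x.exists_cls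
  obtain ⟨m, L', R', hL', hR', γ, rfl⟩ := y.exists_cls
  rw [swapHalves_conj, inLeft_cls]
  exact left_block_commute_right_block hL hR hL' hR' β γ

/-- The element of `bV` which reassociates three parts. -/
def assoc3 : BV := cls 3 (.node () caret .nil) (.node () .nil caret) (by simp) (by simp) 1

theorem cls_one_expand {n : ℕ} {L R L' R' : PTree} (hL : L.numLeaves = n) (hR : R.numLeaves = n)
    {k : ℕ} (hk : k < n) (eL : L' = addCaret L k) (eR : R' = addCaret R k) :
    cls (n + 1) L' R' (by rw [eL, numLeaves_addCaret, hL]) (by rw [eR, numLeaves_addCaret, hR]) 1 =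
      cls n L R hL hR 1 :=
  cls_expand hL hR 1 ⟨k, hk⟩ (by rw [map_one]; exact eL) eR (bifurcate_one _).symm

theorem assoc3_eq (A B C : PTree) : ∀ (n : ℕ) (h : A.numLeaves + B.numLeaves + C.numLeaves = n),
    cls n (.node () (.node () A B) C) (.node () A (.node () B C)) (numLeaves_assoc_left h)
      (numLeaves_assoc_right h) 1 = assoc3 := by
  induction A using tree_induction with
  | hnil =>
    induction B using tree_induction with
    | hnil =>
      induction C using tree_induction with
      | hnil => rintro n rfl; rfl
      | hadd C k hk ih =>
        intro n h
        rw [numLeaves_addCaret, ← add_assoc] at h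
        subst h
        rw [← ih _ rfl]
        refine cls_one_expand _ _ (k := 2 + k) (by simp only [BinaryTree.numLeaves]; omega) ?_ ?_
        · rw [addCaret_node_right (j := k) (by simp)]
        · rw [addCaret_node_right (j := 1 + k) (by simp; omega),
            addCaret_node_right (j := k) (by simp)]
    | hadd B k hk ih =>
      intro n h
      rw [numLeaves_addCaret] at h
      obtain rfl : n = BinaryTree.nil.numLeaves + B.numLeaves + C.numLeaves + 1 := by omega
      rw [← ih _ rfl]
      refine cls_one_expand _ _ (k := 1 + k) (by simp only [BinaryTree.numLeaves]; omega) ?_ ?_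
      · rw [addCaret_node_left (by simp only [BinaryTree.numLeaves]; omega),
          addCaret_node_right (j := k) (by simp)]
      · rw [addCaret_node_right (j := k) (by simp), addCaret_node_left hk]
  | hadd A k hk ih =>
    intro n h
    rw [numLeaves_addCaret] at h
    obtain rfl : n = A.numLeaves + B.numLeaves + C.numLeaves + 1 := by omega
    rw [← ih _ rfl]
    refine cls_one_expand _ _ (k := k) (by omega) ?_ ?_
    · rw [addCaret_node_left (by rw [numLeaves_node]; omega), addCaret_node_left hk]
    · rw [addCaret_node_left hk]

theorem assoc3_conj {n : ℕ} {A B C A' B' C' : PTree}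
    (h : A.numLeaves + B.numLeaves + C.numLeaves = n)
    (h' : A'.numLeaves + B'.numLeaves + C'.numLeaves = n) (β : Braid n) :
    cls n (.node () (.node () A B) C) (.node () (.node () A' B') C') (numLeaves_assoc_left h)
        (numLeaves_assoc_left h') β =
      assoc3 * cls n (.node () A (.node () B C)) (.node () A' (.node () B' C'))
        (numLeaves_assoc_right h) (numLeaves_assoc_right h') β * assoc3⁻¹ := by
  rw [eq_mul_inv_iff_mul_eq]
  nth_rw 1 [← assoc3_eq A' B' C' n h']
  rw [← assoc3_eq A B C n h, cls_mul, cls_mul, mul_one, one_mul]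

/-- With a caret hung on their last leaf, the trees of `inLeft x` have three parts, grouped to the
right; grouping them to the left gives the trees of `inLeft (inLeft x)`, with the same braid. -/
theorem inLeft_inLeft (x : BV) : inLeft (inLeft x) = assoc3 * inLeft x * assoc3⁻¹ := by
  obtain ⟨n, L, R, hL, hR, β, rfl⟩ := x.exists_cls
  rw [inLeft_cls, inLeft_cls, shiftHom_shiftHom, ← cls_left_block hL hR β caret (n + 1 + 1) rfl]
  exact assoc3_conj (n := n + 1 + 1) (by simp [hL]) (by simp [hR]) _

end BraidedThompson

/-! ### Vanishing of additive functions on bV, and boundedness of quasimorphisms on the subgroup. -/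

namespace BraidedThompson

/-! ### Homomorphisms from `bV` to the reals -/

theorem additive_one {f : BV → ℝ} (hf : ∀ x y, f (x * y) = f x + f y) : f 1 = 0 := by
  have := hf 1 1
  rw [mul_one] at this
  linarith

theorem additive_conj_cls {f : BV → ℝ} (hf : ∀ x y, f (x * y) = f x + f y) {n : ℕ} {T T' : PTree}
    (h : T.numLeaves = n) (h' : T'.numLeaves = n) (β : Braid n) :
    f (cls n T T h h β) = f (cls n T' T' h' h' β) := by
  have e1 : cls n T T' h h' 1 * cls n T' T' h' h' β * cls n T' T h' h 1 = cls n T T h h β := by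
    rw [cls_mul, cls_mul, one_mul, mul_one]
  have e2 : cls n T T' h h' 1 * cls n T' T h' h 1 = 1 := by rw [cls_mul, one_mul, cls_one]
  have h1 := additive_one hf
  rw [← e2, hf] at h1
  rw [← e1, hf, hf]
  linarith

theorem additive_sigma_succ {f : BV → ℝ} (hf : ∀ x y, f (x * y) = f x + f y) {n i : ℕ}
    {T : PTree} (h : T.numLeaves = n) (hi : i + 2 < n) :
    f (cls n T T h h (sigma n (i + 1))) = f (cls n T T h h (sigma n i)) := by
  have h1 := congrArg (fun β => f (cls n T T h h β)) (sigma_braid hi)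
  simp only [← cls_mul h h h, hf] at h1
  linarith

theorem additive_sigma {f : BV → ℝ} (hf : ∀ x y, f (x * y) = f x + f y) {n i : ℕ}
    {T : PTree} (h : T.numLeaves = n) (hi : i + 1 < n) :
    f (cls n T T h h (sigma n i)) = f (cls n T T h h (sigma n 0)) := by
  induction i with
  | zero => rfl
  | succ i ih => rw [additive_sigma_succ hf h hi, ih (by omega)]

/-- Bifurcating a strand of the squared crossing gives four crossings. The square is used because it
is pure, so that the two trees remain equal. -/
theorem additive_sigma_double {f : BV → ℝ} (hf : ∀ x y, f (x * y) = f x + f y) {n : ℕ}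
    {T : PTree} (h : T.numLeaves = n) {T' : PTree} (h' : T'.numLeaves = n + 1) (hn : 2 ≤ n) :
    f (cls n T T h h (sigma n 0)) = 2 * f (cls (n + 1) T' T' h' h' (sigma (n + 1) 0)) := by
  have hs : (addCaret T 0).numLeaves = n + 1 := by rw [numLeaves_addCaret, h]
  have e : cls (n + 1) (addCaret T 0) (addCaret T 0) hs hs
      (sigma (n + 1) 1 * sigma (n + 1) 0 * (sigma (n + 1) 0 * sigma (n + 1) 1)) =
      cls n T T h h (sigma n 0 * sigma n 0) := by
    have hr : rho (sigma n 0) ⟨0, by omega⟩ = ⟨1, by omega⟩ :=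
      Fin.ext (rho_sigma_val (by omega) _)
    have hr' : rho (sigma n 0) ⟨1, by omega⟩ = ⟨0, by omega⟩ :=
      Fin.ext (rho_sigma_val (by omega) _)
    refine cls_expand _ _ _ ⟨0, by omega⟩ ?_ rfl ?_
    · rw [map_mul, Equiv.Perm.mul_apply, hr, hr']
    · rw [bifurcate_mul, hr, bifurcate_sigma (by omega), bifurcate_sigma (by omega)]
      exact (congrArg₂ (· * ·) (genBif_succ n 0) (genBif_self n 0)).symm
  have e' := congrArg f e
  simp only [← cls_mul hs hs hs, ← cls_mul h h h, hf] at e'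
  rw [additive_sigma hf hs (i := 1) (by omega), additive_conj_cls hf hs h'] at e'
  linarith

/-- A third strand can be bifurcated without affecting the crossing, so the value does not change
from `n` to `n + 1`, whereas `additive_sigma_double` halves it. Two strands reduce to three. -/
theorem additive_sigma_zero {f : BV → ℝ} (hf : ∀ x y, f (x * y) = f x + f y) {n : ℕ}
    {T : PTree} (h : T.numLeaves = n) (hn : 2 ≤ n) : f (cls n T T h h (sigma n 0)) = 0 := by
  have key : ∀ {n : ℕ} {T : PTree} (h : T.numLeaves = n), 3 ≤ n →
      f (cls n T T h h (sigma n 0)) = 0 := by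
    intro n T h hn
    have hs : (addCaret T 2).numLeaves = n + 1 := by rw [numLeaves_addCaret, h]
    have hr : rho (sigma n 0) ⟨2, by omega⟩ = ⟨2, by omega⟩ :=
      Fin.ext (rho_sigma_val (by omega) _)
    have e : cls (n + 1) (addCaret T 2) (addCaret T 2) hs hs (sigma (n + 1) 0) =
        cls n T T h h (sigma n 0) := by
      refine cls_expand _ _ _ ⟨2, by omega⟩ (by rw [hr]) rfl ?_
      rw [bifurcate_sigma (by omega), genBif_gt n (by simp)]
    have h1 := additive_sigma_double hf h hs (by omega)
    rw [e] at h1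
    linarith
  rw [additive_sigma_double hf h (T' := addCaret T 0) (by rw [numLeaves_addCaret, h]) hn,
    key _ (by omega), mul_zero]

theorem additive_braid {f : BV → ℝ} (hf : ∀ x y, f (x * y) = f x + f y) {n : ℕ}
    {T : PTree} (h : T.numLeaves = n) (β : Braid n) : f (cls n T T h h β) = 0 := by
  induction β using braid_induction with
  | h1 => rw [cls_one, additive_one hf]
  | hof i =>
    have := i.2
    rw [of_eq_sigma, additive_sigma hf h (by omega), additive_sigma_zero hf h (by omega)]
  | hmul β γ hβ hγ => rw [← cls_mul h h h, hf, hβ, hγ, add_zero]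
  | hinv β hβ =>
    have e : f (cls n T T h h (β * β⁻¹)) = f (cls n T T h h β) + f (cls n T T h h β⁻¹) := by
      rw [← cls_mul h h h, hf]
    rw [mul_inv_cancel, cls_one, additive_one hf, hβ] at e
    linarith

theorem additive_trees_trans {f : BV → ℝ} (hf : ∀ x y, f (x * y) = f x + f y) {n : ℕ}
    {T U W : PTree} (hT : T.numLeaves = n) (hU : U.numLeaves = n) (hW : W.numLeaves = n)
    (h1 : f (cls n T U hT hU 1) = 0) (h2 : f (cls n U W hU hW 1) = 0) :
    f (cls n T W hT hW 1) = 0 := by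
  have := hf (cls n T U hT hU 1) (cls n U W hU hW 1)
  rwa [cls_mul, one_mul, h1, h2, add_zero] at this

theorem additive_trees_symm {f : BV → ℝ} (hf : ∀ x y, f (x * y) = f x + f y) {n : ℕ}
    {T U : PTree} (hT : T.numLeaves = n) (hU : U.numLeaves = n)
    (h1 : f (cls n T U hT hU 1) = 0) : f (cls n U T hU hT 1) = 0 := by
  have := hf (cls n T U hT hU 1) (cls n U T hU hT 1)
  rw [cls_mul, one_mul, h1, zero_add, cls_one, additive_one hf] at this
  exact this.symm

/-- Expanding the crossing `sigma n k` at `k` puts carets on the neighbouring leaves `k + 1` and `k`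
of the two copies of `S`. So moving a caret to a neighbouring leaf agrees, up to braids on a single
tree, with such a braid, and those have value zero. -/
theorem additive_addCaret {f : BV → ℝ} (hf : ∀ x y, f (x * y) = f x + f y) {n : ℕ}
    {S : PTree} (hS : ∀ k, (addCaret S k).numLeaves = n + 1) (k : ℕ) (hk : k < n) :
    f (cls (n + 1) (addCaret S k) (addCaret S 0) (hS k) (hS 0) 1) = 0 := by
  induction k with
  | zero => rw [cls_one, additive_one hf]
  | succ k ih =>
    refine additive_trees_trans hf _ (hS k) _ ?_ (ih (by omega))
    have h : S.numLeaves = n := by have := hS 0; rw [numLeaves_addCaret] at this; omega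
    have e : cls (n + 1) (addCaret S (k + 1)) (addCaret S k) (hS _) (hS _)
        (bifurcate ⟨k, by omega⟩ (sigma n k)) = cls n S S h h (sigma n k) := by
      refine cls_expand _ _ _ ⟨k, by omega⟩ ?_ rfl rfl
      rw [rho_sigma_val hk, natSwap_self]
    have e' := congrArg f e
    rw [additive_braid hf] at e'
    rw [← mul_one (bifurcate _ _), ← cls_mul _ (hS (k + 1)), hf, additive_braid hf,
      zero_add] at e'
    exact e'

theorem exists_addCaret (T : PTree) :
    T = .nil ∨ ∃ S k, k < S.numLeaves ∧ T = addCaret S k := by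
  induction T using tree_induction with
  | hnil => exact Or.inl rfl
  | hadd T k hk _ => exact Or.inr ⟨T, k, hk, rfl⟩

/-- Move a caret of either tree to the leaf `0` of the remaining tree, then cancel the common caret
and induct. -/
theorem additive_trees {f : BV → ℝ} (hf : ∀ x y, f (x * y) = f x + f y) (n : ℕ) :
    ∀ (T U : PTree) (hT : T.numLeaves = n) (hU : U.numLeaves = n),
      f (cls n T U hT hU 1) = 0 := by
  induction n with
  | zero => intro T U hT; have := numLeaves_pos T; omega
  | succ n ih =>
    intro T U hT hU
    rcases exists_addCaret T with rfl | ⟨S, j, hj, rfl⟩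
    · rcases exists_addCaret U with rfl | ⟨S', k, hk, rfl⟩
      · rw [cls_one, additive_one hf]
      · rw [numLeaves_addCaret] at hU
        have := numLeaves_pos S'
        simp at hT
        omega
    · rcases exists_addCaret U with rfl | ⟨S', k, hk, rfl⟩
      · rw [numLeaves_addCaret] at hT
        have := numLeaves_pos S
        simp at hU
        omega
      · have hS : S.numLeaves = n := by rw [numLeaves_addCaret] at hT; omega
        have hS' : S'.numLeaves = n := by rw [numLeaves_addCaret] at hU; omega
        have c1 : ∀ k, (addCaret S k).numLeaves = n + 1 := fun k => by
          rw [numLeaves_addCaret, hS]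
        have c2 : ∀ k, (addCaret S' k).numLeaves = n + 1 := fun k => by
          rw [numLeaves_addCaret, hS']
        refine additive_trees_trans hf _ (c1 0) _ (additive_addCaret hf c1 j (by omega)) ?_
        refine additive_trees_trans hf _ (c2 0) _ ?_
          (additive_trees_symm hf _ _ (additive_addCaret hf c2 k (by omega)))
        rw [cls_one_expand hS hS' (k := 0) (by omega) rfl rfl]
        exact ih S S' hS hS'

/-- There are no non-trivial homomorphisms from `bV` to the reals. -/
theorem additive_eq_zero {f : BV → ℝ} (hf : ∀ x y, f (x * y) = f x + f y) (x : BV) : f x = 0 := by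
  obtain ⟨n, L, R, hL, hR, β, rfl⟩ := x.exists_cls
  rw [← mul_one β, ← cls_mul hL hL hR, hf, additive_braid hf, additive_trees hf, add_zero]

theorem IsHomogeneous.inLeft_eq_zero {φ : BV → ℝ} (h : IsHomogeneous φ) (x : BV) :
    φ (inLeft x) = 0 :=
  additive_eq_zero (f := fun x => φ (inLeft x))
    (h.map_mul_of_commuting_conjugate inLeft swapHalves assoc3 inLeft_commute inLeft_inLeft) x

/-! ### The germ at the last leaf -/

/-- The depth of the last leaf of a tree. -/
def rightDepth : PTree → ℕ
  | .nil => 0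
  | .node _ _ r => rightDepth r + 1

theorem rightDepth_addCaret (T : PTree) {k : ℕ} (hk : k < T.numLeaves) :
    rightDepth (addCaret T k) = rightDepth T + if k + 1 = T.numLeaves then 1 else 0 := by
  induction T generalizing k with
  | nil =>
    obtain rfl : k = 0 := by simpa using hk
    simp [addCaret, rightDepth]
  | node _ l r hl hr =>
    rw [numLeaves_node] at hk ⊢
    have := numLeaves_pos r
    rw [addCaret]
    split_ifs with h1 h2 h2
    · omega
    · rfl
    · rw [rightDepth, hr (by omega), if_pos (by omega), rightDepth]
    · rw [rightDepth, hr (by omega), if_neg (by omega), rightDepth]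

theorem hatBraid_le_range {n : ℕ} {β : Braid (n + 1)} (h : β ∈ hatBraid (n + 1)) :
    ∃ γ : Braid n, shiftHom 0 n (n + 1) (by omega) γ = β := by
  have : hatBraid (n + 1) ≤ (shiftHom 0 n (n + 1) (by omega)).range := by
    refine (Subgroup.closure_le _).2 ?_
    rintro _ ⟨i, hi, rfl⟩
    exact ⟨sigma n i, by rw [shiftHom_sigma _ (by omega), zero_add]⟩
  exact this h

theorem rho_hatBraid {n : ℕ} {β : Braid n} (h : β ∈ hatBraid n) (k : Fin n) :
    ((rho β k : Fin n) : ℕ) + 1 = n ↔ (k : ℕ) + 1 = n := by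
  obtain ⟨n, rfl⟩ : ∃ m, n = m + 1 := ⟨n - 1, by have := k.2; omega⟩
  obtain ⟨γ, rfl⟩ := hatBraid_le_range h
  have e := rho_shiftHom_out (a := 0) (n := n) (m := n + 1) (by omega) γ (Fin.last n)
    (Or.inr (by simp))
  have h1 : ∀ j : Fin (n + 1), (j : ℕ) + 1 = n + 1 ↔ j = Fin.last n := fun j => by
    rw [Fin.ext_iff, Fin.val_last]; omega
  rw [h1, h1]
  constructor
  · intro h2
    exact (rho _).injective (h2.trans e.symm)
  · rintro rfl; exact e

/-- The difference of the depths of the last leaves of the two trees of a triple. -/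
def Triple.germ (t : Triple) : ℤ := rightDepth t.left - rightDepth t.right

/-- The last strand joins the two last leaves, so an expansion deepens both of them or neither. -/
theorem germ_expands {a b : Triple} (h : Relation.ReflTransGen Expands a b)
    (ha : a.braid ∈ hatBraid a.n) : b.germ = a.germ := by
  induction h with
  | refl => rfl
  | @tail b c hb hs ih =>
    obtain ⟨k, rfl⟩ := hs
    rw [← ih]
    have h1 := rho_hatBraid (expands_mem_hatBraid hb ha) k
    have h2 := rightDepth_addCaret b.left (k := rho b.braid k)
      (by rw [b.left_leaves]; exact Fin.is_lt _)
    have h3 := rightDepth_addCaret b.right (k := k) (by rw [b.right_leaves]; exact k.2)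
    rw [b.left_leaves] at h2
    rw [b.right_leaves] at h3
    simp only [Triple.germ, Triple.expand, h2, h3, h1]
    push_cast
    ring

/-- `x` is represented by a triple which braids only the first strands, with the given germ at the
last leaf. -/
def HasGerm (x : BV) (m : ℤ) : Prop :=
  ∃ t : Triple, t.toBV = x ∧ t.braid ∈ hatBraid t.n ∧ t.germ = m

theorem HasGerm.mul {x y : BV} {k l : ℤ} (hx : HasGerm x k) (hy : HasGerm y l) :
    HasGerm (x * y) (k + l) := by
  obtain ⟨a, rfl, ha, rfl⟩ := hx
  obtain ⟨b, rfl, hb, rfl⟩ := hy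
  obtain ⟨a', b', c', h1, h2, h3⟩ := exists_comp a b
  have ha' := expands_mem_hatBraid h1 ha
  have hb' := expands_mem_hatBraid h2 hb
  rw [← germ_expands h1 ha, ← germ_expands h2 hb, toBV_eq h1, toBV_eq h2, h3.toBV_mul]
  cases h3
  exact ⟨_, rfl, mul_mem ha' hb', by simp [Triple.germ]⟩

theorem HasGerm.inv {x : BV} {k : ℤ} (hx : HasGerm x k) : HasGerm x⁻¹ (-k) := by
  obtain ⟨a, rfl, ha, rfl⟩ := hx
  exact ⟨a.inv, rfl, (hatBraid a.n).inv_mem ha, by simp [Triple.germ, Triple.inv]⟩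

theorem HasGerm.zpow {x : BV} {k : ℤ} (hx : HasGerm x k) (m : ℤ) : HasGerm (x ^ m) (m * k) := by
  induction m using Int.induction_on with
  | zero =>
    rw [zpow_zero, zero_mul]
    exact ⟨_, rfl, one_mem _, sub_self _⟩
  | succ m ih =>
    rw [zpow_add_one, add_mul, one_mul]
    exact ih.mul hx
  | pred m ih =>
    rw [zpow_sub_one, sub_mul, one_mul]
    exact ih.mul hx.inv

/-- At depth one the last leaf is the whole right half, and the element lies in the image of
`inLeft`. Conjugation by `assoc3` lifts the last leaves of both trees by one level and leaves the
braid unchanged. -/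
theorem IsHomogeneous.cls_eq_zero {φ : BV → ℝ} (h : IsHomogeneous φ) (d n : ℕ) (L R : PTree)
    (hL : L.numLeaves = n) (hR : R.numLeaves = n) (β : Braid n) (hβ : β ∈ hatBraid n)
    (dL : rightDepth L = d + 1) (dR : rightDepth R = d + 1) : φ (cls n L R hL hR β) = 0 := by
  induction d generalizing L R with
  | zero =>
    rcases L with _ | ⟨_, A, _ | ⟨_, B, C⟩⟩
    · simp [rightDepth] at dL
    · rcases R with _ | ⟨_, A', _ | ⟨_, B', C'⟩⟩
      · simp [rightDepth] at dR
      · rw [numLeaves_node] at hL hR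
        subst hL
        obtain ⟨γ, rfl⟩ := hatBraid_le_range hβ
        rw [← h.inLeft_eq_zero (cls A.numLeaves A A' rfl (Nat.add_right_cancel hR) γ), inLeft_cls]
        rfl
      · simp [rightDepth] at dR
    · simp [rightDepth] at dL
  | succ d ih =>
    rcases L with _ | ⟨_, A, _ | ⟨_, B, C⟩⟩
    · simp [rightDepth] at dL
    · simp [rightDepth] at dL
    · rcases R with _ | ⟨_, A', _ | ⟨_, B', C'⟩⟩
      · simp [rightDepth] at dR
      · simp [rightDepth] at dR
      · have e := assoc3_conj (A := A) (B := B) (C := C) (A' := A') (B' := B') (C' := C') (n := n)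
          (by rw [← hL, add_assoc]; rfl) (by rw [← hR, add_assoc]; rfl) β
        have e' := congrArg φ e
        rw [h.conj] at e'
        refine e'.symm.trans (ih _ _ _ _ ?_ ?_)
        · simp only [rightDepth] at dL ⊢; omega
        · simp only [rightDepth] at dR ⊢; omega

theorem IsHomogeneous.eq_zero_of_hasGerm {φ : BV → ℝ} (h : IsHomogeneous φ) {x : BV}
    (hx : HasGerm x 0) : φ x = 0 := by
  obtain ⟨t, rfl, ht, h0⟩ := hx
  have hpos : 0 < t.n := t.right_leaves ▸ numLeaves_pos t.right
  -- Expanding at the last leaf makes both depths positive, as `cls_eq_zero` requires.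
  have hs : Relation.ReflTransGen Expands t (t.expand ⟨t.n - 1, by omega⟩) := .single ⟨_, rfl⟩
  have hg := germ_expands hs ht
  have hβ := expands_mem_hatBraid hs ht
  have hR : rightDepth (t.expand ⟨t.n - 1, by omega⟩).right = rightDepth t.right + 1 := by
    have := rightDepth_addCaret t.right (k := t.n - 1) (by rw [t.right_leaves]; omega)
    rwa [if_pos (by rw [t.right_leaves]; omega)] at this
  rw [h0, Triple.germ, sub_eq_zero, Nat.cast_inj] at hg
  rw [toBV_eq hs]
  exact h.cls_eq_zero _ _ _ _ _ _ _ hβ (hg.trans hR) hR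

/-- The correcting element is `assoc3` acting on the right half, of germ `-1`. Its powers are
conjugate into the image of `inLeft`, so `φ` vanishes on them, as it does on the corrected element;
only the defect remains. -/
theorem IsHomogeneous.bounded_bVhat {φ : BV → ℝ} (h : IsHomogeneous φ) :
    ∃ D : ℝ, ∀ x ∈ bVhat, |φ x| ≤ D := by
  obtain ⟨D, hD⟩ := h.quasi
  refine ⟨D, fun x hx => ?_⟩
  obtain ⟨t, ht, hβ⟩ := hx
  have hy : HasGerm (swapHalves * inLeft assoc3 * swapHalves⁻¹) (-1) := by
    have e := swapHalves_conj (n := 3) (L := .node () caret .nil) (R := .node () .nil caret)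
      (by simp) (by simp) 1
    refine ⟨_, e.symm, ?_, ?_⟩
    · rw [map_one]; exact one_mem _
    · simp [Triple.germ, rightDepth]
  have h1 := h.eq_zero_of_hasGerm (x := x * (swapHalves * inLeft assoc3 * swapHalves⁻¹) ^ t.germ) (by
    have := HasGerm.mul ⟨t, ht, hβ, rfl⟩ (hy.zpow t.germ)
    rwa [mul_neg_one, add_neg_cancel] at this)
  have h2 : φ ((swapHalves * inLeft assoc3 * swapHalves⁻¹) ^ t.germ) = 0 := by
    rw [conj_zpow, h.conj, ← map_zpow, h.inLeft_eq_zero]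
  have h3 := hD x ((swapHalves * inLeft assoc3 * swapHalves⁻¹) ^ t.germ)
  rwa [h1, h2, add_zero, sub_zero] at h3

theorem isBounded_image_bVhat {q : BV → ℝ} (hq : IsQuasimorphism q) :
    Bornology.IsBounded (q '' (bVhat : Set BV)) := by
  obtain ⟨φ, h, C, hC⟩ := exists_homogenization hq
  obtain ⟨D, hD⟩ := h.bounded_bVhat
  refine isBounded_iff_forall_norm_le.2 ⟨C + D, ?_⟩
  rintro _ ⟨x, hx, rfl⟩
  have h1 := hC x
  have h2 := hD x hx
  rw [Real.norm_eq_abs]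
  rw [abs_le] at *
  constructor <;> linarith

end BraidedThompson

theorem corollary4p7 :
    (∀ q : BraidedThompson.BV → ℝ, BraidedThompson.IsQuasimorphism q →
      Bornology.IsBounded (q '' (BraidedThompson.bVhat : Set BraidedThompson.BV))) ∧
    ¬ ∃ N : ℕ, ∀ g : BraidedThompson.BV, ∃ L : List BraidedThompson.BV, L.length ≤ N ∧
      (∀ x ∈ L, ∃ h ∈ BraidedThompson.bVhat, ∃ c : BraidedThompson.BV, x = c * h * c⁻¹) ∧
      L.prod = g :=
  ⟨fun _ => BraidedThompson.isBounded_image_bVhat,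
    BraidedThompson.not_bounded_conjugate_factorisation⟩
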